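/- Let $M$ be a smooth $n$-dimensional manifold with tangent projection $\pi:TM\to M$, and let $(M,L)$ be a pseudo-Finsler manifold. That is, $A\subset TM\setminus\mathbf 0$ is an open subset of $TM$ with $\pi(A)=M$ and $\lambda v\in A$ for all $v\in A$, $\lambda>0$. Moreover, $L:A\to\mathbb R$ is a smooth function with $L(\lambda v)=\lambda^2L(v)$ for all $v\in A$, $\lambda>0$, whose fundamental tensor $$g_v(u,w)=\tfrac12\,\frac{\partial^2}{\partial t\,\partial s}L(v+tu+sw)\Big|_{t=s=0},\qquad u,w\in T_{\pi(v)}M,$$ is nondegenerate for every $v\in A$. Let $C_v(w_1,w_2,w_3)=\frac12\frac{\partial}{\partial z}g_{v+zw_1}(w_2,w_3)|_{z=0}$ be the Cartan tensor. For a vector field $V$ on an open set with values in $A$, let $\nabla^V$ be the Chern connection, i.e. the torsion-free affine connection with $$X(g_V(Y,Z))=g_V(\nabla^V_XY,Z)+g_V(Y,\nabla^V_XZ)+2C_V(\nabla^V_XV,Y,Z).$$ Its Christoffel symbols in a chart are $\Gamma^k_{ij}(V)=\Gamma^k_{ij}\circ V$ for smooth functions $\Gamma^k_{ij}$ on the part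 of $A$ over the chart domain. For a smooth curve $\gamma$ and vector fields $W,X$ along $\gamma$ with $W$ taking values in $A$, let $D^W_\gamma X$ be the vector field along $\gamma$ with components $$\dot X^k+\sum_{i,j}X^i\dot\gamma^j\,\Gamma^k_{ij}(W).$$ Let $a<b$. A smooth curve $\gamma:[a,b]\to M$ is $L$-admissible if $\dot\gamma(t)\in A$ for all $t\in[a,b]$. It is a geodesic if in addition $D^{\dot\gamma}_\gamma\dot\gamma=0$. For a smooth map $\Lambda:[a,b]\times(-\varepsilon,\varepsilon)\to M$, $\varepsilon>0$, put $\gamma_s(t)=\beta_t(s)=\Lambda(t,s)$, $\Lambda_t(t,s)=\dot\gamma_s(t)$ and $\Lambda_s(t,s)=\dot\beta_t(s)$. The map $\Lambda$ is an $L$-admissible variation of $\gamma$ if $\gamma_0=\gamma$ and all $\gamma_s$ are $L$-admissible; its variation vector field is $W(t)=\Lambda_s(t,0)$. For an $L$-admissible $\gamma$ and smooth vector fields $W,Z$ along $\gamma$, let $$R^\gamma(\dot\gamma,W)Z(t)=\left(D^{\Lambda_t}_{\gamma_s}D^{\Lambda_t}_{\beta_t}\tilde Z-D^{\Lambda_t}_{\beta_t}D^{\Lambda_t}_{\gamma_s}\tilde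 Z\right)(t,0),$$ where $\Lambda$ is any $L$-admissible variation of $\gamma$ with variation vector field $W$, and $\tilde Z$ is any smooth vector field along $\Lambda$ with $\tilde Z(t,0)=Z(t)$; the value does not depend on these choices. A smooth vector field $J$ along a geodesic $\gamma$ is a Jacobi field if $$J''=R^\gamma(\dot\gamma,J)\dot\gamma,\qquad\text{where } J'=D^{\dot\gamma}_\gamma J.$$ Proposition. Let $\Lambda:[a,b]\times(-\varepsilon,\varepsilon)\to M$ be a smooth map such that $\gamma_s=\Lambda(\cdot,s)$ is a geodesic of $(M,L)$ for every $s\in(-\varepsilon,\varepsilon)$. Then the variation vector field $J(t)=\Lambda_s(t,0)$ is a Jacobi field of the geodesic $\gamma_0$. (This includes the claim that $R^{\gamma_0}(\dot\gamma_0,J)\dot\gamma_0$ is independent of the choice of variation and extension.) -/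

import Mathlib

open Set
open scoped Manifold ContDiff

noncomputable section

/-- A (conic, two-homogeneous) pseudo-Finsler metric on a smooth manifold `M` modelled on `E`: an
open conic set `A` of nonzero tangent vectors that projects onto `M`, and a smooth function `L` on
`A` (its values off `A` are irrelevant), positively homogeneous of degree two, whose fundamental
tensor `g_v(u, w) = (1/2) ∂²/∂t∂s L(v + t u + s w) |_{t = s = 0}` is nondegenerate for `v ∈ A`. -/
structure PseudoFinsler (E : Type*) [NormedAddCommGroup E] [NormedSpace ℝ E]
    (M : Type*) [TopologicalSpace M] [ChartedSpace E M] [IsManifold 𝓘(ℝ, E) ∞ M] where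
  /-- the conic domain -/
  A : Set (TangentBundle 𝓘(ℝ, E) M)
  isOpen_A : IsOpen A
  ne_zero : ∀ (p : M) (v : TangentSpace 𝓘(ℝ, E) p),
    (⟨p, v⟩ : TangentBundle 𝓘(ℝ, E) M) ∈ A → v ≠ 0
  exists_mem : ∀ p : M, ∃ v : TangentSpace 𝓘(ℝ, E) p, (⟨p, v⟩ : TangentBundle 𝓘(ℝ, E) M) ∈ A
  smul_mem : ∀ (p : M) (v : TangentSpace 𝓘(ℝ, E) p) (r : ℝ), 0 < r →
    (⟨p, v⟩ : TangentBundle 𝓘(ℝ, E) M) ∈ A → (⟨p, r • v⟩ : TangentBundle 𝓘(ℝ, E) M) ∈ A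
  /-- the metric function -/
  L : TangentBundle 𝓘(ℝ, E) M → ℝ
  smooth_L : ContMDiffOn 𝓘(ℝ, E).tangent 𝓘(ℝ, ℝ) ∞ L A
  homogeneous : ∀ (p : M) (v : TangentSpace 𝓘(ℝ, E) p) (r : ℝ), 0 < r →
    (⟨p, v⟩ : TangentBundle 𝓘(ℝ, E) M) ∈ A →
      L (⟨p, r • v⟩ : TangentBundle 𝓘(ℝ, E) M) = r ^ 2 * L (⟨p, v⟩ : TangentBundle 𝓘(ℝ, E) M)
  nondegenerate : ∀ (p : M) (v : TangentSpace 𝓘(ℝ, E) p),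
    (⟨p, v⟩ : TangentBundle 𝓘(ℝ, E) M) ∈ A → ∀ u : TangentSpace 𝓘(ℝ, E) p,
      (∀ w : TangentSpace 𝓘(ℝ, E) p,
        (1 / 2 : ℝ) * deriv (fun t : ℝ => deriv (fun s : ℝ =>
          L (⟨p, v + t • u + s • w⟩ : TangentBundle 𝓘(ℝ, E) M)) 0) 0 = 0) → u = 0

namespace ChernAlgebra

section

variable {E : Type*} [NormedAddCommGroup E] [NormedSpace ℝ E]

/-- Christoffel symbols of the first kind of a family of symmetric bilinear forms with
directional derivatives `T` (`T u = ∂_u g`):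
`firstKind T w u z = (1/2) (∂_u g(w, z) + ∂_w g(u, z) - ∂_z g(w, u))`. -/
def firstKind (T : E →L[ℝ] E →L[ℝ] E →L[ℝ] ℝ) (w : E) : E →L[ℝ] E →L[ℝ] ℝ :=
  (1 / 2 : ℝ) • (T.flip w + T w - (T.flip w).flip)

/-- The vector `Γ(v, v)`: raise the index of `[v v, ·]`. -/
def spray (g : E →L[ℝ] E →L[ℝ] ℝ) (T : E →L[ℝ] E →L[ℝ] E →L[ℝ] ℝ) (v : E) : E :=
  ContinuousLinearMap.inverse g (firstKind T v v)

/-- The nonlinear connection `N(u) = Γ(u, v)`, that is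
`g(N(u), z) = [u v, z] - C(Γ(v, v), u, z)`. -/
def nonlin (g : E →L[ℝ] E →L[ℝ] ℝ) (T C : E →L[ℝ] E →L[ℝ] E →L[ℝ] ℝ) (v : E) : E →L[ℝ] E :=
  (ContinuousLinearMap.inverse g).comp (firstKind T v - C (spray g T v))

/-- The Christoffel symbols of the Chern connection at `v`, as a bilinear map (in a basis
`christoffel g T C v e_i e_j = ∑ Γ^k_{ij}(v) e_k`), given by the Koszul formula
`g(Γ(u, w), z) = [u w, z] - C(w, N(u), z) - C(u, N(w), z) + C(u, w, N(z))`. -/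
def christoffel (g : E →L[ℝ] E →L[ℝ] ℝ) (T C : E →L[ℝ] E →L[ℝ] E →L[ℝ] ℝ) (v u w : E) : E :=
  ContinuousLinearMap.inverse g
    (firstKind T w u - C w (nonlin g T C v u) - C u (nonlin g T C v w)
      + (C u w).comp (nonlin g T C v))

/-- The Christoffel symbols above are the ones of the torsion-free, almost `g`-compatible
connection: in coordinates these two axioms read `Γ(u, w) = Γ(w, u)` and
`∂_u g(w, z) = g(Γ(u, w), z) + g(w, Γ(u, z)) + 2 C(Γ(u, v), w, z)` (the terms that contain
derivatives of the reference field cancel, since `C` is half the fibre derivative of `g`). -/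
theorem christoffel_spec (g : E ≃L[ℝ] (E →L[ℝ] ℝ)) (T C : E →L[ℝ] E →L[ℝ] E →L[ℝ] ℝ) (v : E)
    (hg : ∀ u w, g u w = g w u) (hT : ∀ z u w, T z u w = T z w u)
    (hC₁ : ∀ z u w, C z u w = C z w u) (hC₂ : ∀ z u w, C z u w = C u z w)
    (hCv : ∀ u w, C v u w = 0) :
    (∀ u w, christoffel (g : E →L[ℝ] E →L[ℝ] ℝ) T C v u w
        = christoffel (g : E →L[ℝ] E →L[ℝ] ℝ) T C v w u) ∧
    ∀ u w z, T u w z = g (christoffel (g : E →L[ℝ] E →L[ℝ] ℝ) T C v u w) z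
      + g w (christoffel (g : E →L[ℝ] E →L[ℝ] ℝ) T C v u z)
      + 2 * C (christoffel (g : E →L[ℝ] E →L[ℝ] ℝ) T C v u v) w z := by
  have hs : ContinuousLinearMap.inverse (g : E →L[ℝ] E →L[ℝ] ℝ) = (g.symm : (E →L[ℝ] ℝ) →L[ℝ] E) :=
    ContinuousLinearMap.inverse_equiv g
  have hCv' : ∀ u w, C u v w = 0 := fun u w => by rw [hC₂, hCv]
  have hCv'' : ∀ u w, C u w v = 0 := fun u w => by rw [hC₁, hCv']
  have hNv : nonlin (g : E →L[ℝ] E →L[ℝ] ℝ) T C v v = spray (g : E →L[ℝ] E →L[ℝ] ℝ) T v := by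
    simp only [nonlin, spray, ContinuousLinearMap.comp_apply, sub_apply]
    congr 1
    ext z
    simp [hCv']
  have hΓ : ∀ u w z, g (christoffel (g : E →L[ℝ] E →L[ℝ] ℝ) T C v u w) z
      = firstKind T w u z - C w (nonlin (g : E →L[ℝ] E →L[ℝ] ℝ) T C v u) z
        - C u (nonlin (g : E →L[ℝ] E →L[ℝ] ℝ) T C v w) z
        + C u w (nonlin (g : E →L[ℝ] E →L[ℝ] ℝ) T C v z) := by
    intro u w z
    simp [christoffel, hs]
  have hN : ∀ u, christoffel (g : E →L[ℝ] E →L[ℝ] ℝ) T C v u v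
      = nonlin (g : E →L[ℝ] E →L[ℝ] ℝ) T C v u := by
    intro u
    apply g.injective
    ext z
    rw [hΓ, hNv]
    simp only [nonlin, hs, ContinuousLinearMap.comp_apply, sub_apply,
      ContinuousLinearEquiv.coe_coe, ContinuousLinearEquiv.apply_symm_apply, hCv, hCv']
    rw [hC₂ u]
    ring
  have hF : ∀ u w z, firstKind T w u z = (1 / 2) * (T u w z + T w u z - T z w u) := by
    intro u w z
    simp [firstKind]
  refine ⟨fun u w => g.injective ?_, fun u w z => ?_⟩
  · ext z
    rw [hΓ, hΓ, hF, hF, hC₂ u w, hT z w u]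
    ring
  · rw [hg w, hN, hΓ, hΓ, hF, hF, hT w u z, hT z w u, hT u z w, hC₁ w,
      hC₁ z, hC₂ z w, hC₂ w z, hC₂ _ w z]
    rw [hC₁ u w, hC₁ u z, hT w z u]
    have h1 := hC₁ w z (nonlin (g : E →L[ℝ] E →L[ℝ] ℝ) T C v u)
    have h2 := hC₂ w z (nonlin (g : E →L[ℝ] E →L[ℝ] ℝ) T C v u)
    linarith

end

end ChernAlgebra

namespace PseudoFinsler

section

variable {E : Type*} [NormedAddCommGroup E] [NormedSpace ℝ E]
  {M : Type*} [TopologicalSpace M] [ChartedSpace E M] [IsManifold 𝓘(ℝ, E) ∞ M]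

/-- The components, in the chart around `c`, of a tangent vector `v` at `q`. -/
def coordVec (c : M) {q : M} (v : TangentSpace 𝓘(ℝ, E) q) : E :=
  (trivializationAt E (TangentSpace 𝓘(ℝ, E)) c (⟨q, v⟩ : TangentBundle 𝓘(ℝ, E) M)).2

/-- The tangent vector at `q` whose components in the chart around `c` are `v`. -/
def ofCoord (c q : M) (v : E) : TangentSpace 𝓘(ℝ, E) q :=
  (trivializationAt E (TangentSpace 𝓘(ℝ, E)) c).symm q v

/-- The function `L` in the natural coordinates `(x, v)` of the tangent bundle induced by the chart
around `c`. -/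
def localL (F : PseudoFinsler E M) (c : M) (x v : E) : ℝ :=
  F.L (⟨(extChartAt 𝓘(ℝ, E) c).symm x, ofCoord c ((extChartAt 𝓘(ℝ, E) c).symm x) v⟩ :
    TangentBundle 𝓘(ℝ, E) M)

/-- The fundamental tensor in the chart around `c`: half the second fibre derivative of `L`. -/
def localMetric (F : PseudoFinsler E M) (c : M) (x v : E) : E →L[ℝ] E →L[ℝ] ℝ :=
  (1 / 2 : ℝ) • fderiv ℝ (fun v' => fderiv ℝ (F.localL c x) v') v

/-- The Cartan tensor in the chart around `c`: half the fibre derivative of the fundamental tensor,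
that is a quarter of the third fibre derivative of `L`. -/
def localCartan (F : PseudoFinsler E M) (c : M) (x v : E) : E →L[ℝ] E →L[ℝ] E →L[ℝ] ℝ :=
  (1 / 2 : ℝ) • fderiv ℝ (fun v' => F.localMetric c x v') v

/-- The derivative of the fundamental tensor in the position variable, in the chart around `c`. -/
def localMetricDeriv (F : PseudoFinsler E M) (c : M) (x v : E) :
    E →L[ℝ] E →L[ℝ] E →L[ℝ] ℝ :=
  fderiv ℝ (fun x' => F.localMetric c x' v) x

/-- The Christoffel symbols of the Chern connection in the chart around `c`, at the point with
coordinates `x` and the reference vector with components `v`. -/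
def localChristoffel (F : PseudoFinsler E M) (c : M) (x v u w : E) : E :=
  ChernAlgebra.christoffel (F.localMetric c x v) (F.localMetricDeriv c x v)
    (F.localCartan c x v) v u w

/-- The velocity of a curve defined on `S ⊆ ℝ` (one-sided at endpoints that belong to `S`). -/
def velocity (S : Set ℝ) (γ : ℝ → M) (t : ℝ) : TangentSpace 𝓘(ℝ, E) (γ t) :=
  mfderivWithin 𝓘(ℝ, ℝ) 𝓘(ℝ, E) γ S t (1 : ℝ)

/-- The covariant derivative `D^W_γ X` at `t` of a field `X` along the curve `γ` defined on `S`,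
with reference field `W`, computed in the chart around `c`: its components are
`Ẋ^k + ∑ X^i γ̇^j Γ^k_{ij}(W)`. -/
def covDerivInChart (F : PseudoFinsler E M) (c : M) (S : Set ℝ) (γ : ℝ → M)
    (W X : ∀ t, TangentSpace 𝓘(ℝ, E) (γ t)) (t : ℝ) : TangentSpace 𝓘(ℝ, E) (γ t) :=
  ofCoord c (γ t)
    (derivWithin (fun τ => coordVec c (X τ)) S t
      + F.localChristoffel c (extChartAt 𝓘(ℝ, E) c (γ t)) (coordVec c (W t))
          (coordVec c (X t)) (coordVec c (velocity (E := E) S γ t)))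

/-- The covariant derivative `D^W_γ X` induced by the Chern connection; at the parameter `t` it is
computed in the preferred chart around the point `γ t`. -/
def covDeriv (F : PseudoFinsler E M) (S : Set ℝ) (γ : ℝ → M)
    (W X : ∀ t, TangentSpace 𝓘(ℝ, E) (γ t)) (t : ℝ) : TangentSpace 𝓘(ℝ, E) (γ t) :=
  F.covDerivInChart (γ t) S γ W X t

/-- `X` is a smooth vector field along `γ : [a, b] → M`. -/
def IsSmoothFieldAlong (a b : ℝ) (γ : ℝ → M) (X : ∀ t, TangentSpace 𝓘(ℝ, E) (γ t)) : Prop :=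
  ContMDiffOn 𝓘(ℝ, ℝ) 𝓘(ℝ, E).tangent ∞
    (fun t => (⟨γ t, X t⟩ : TangentBundle 𝓘(ℝ, E) M)) (Icc a b)

/-- `γ : [a, b] → M` is `L`-admissible: its velocities lie in the domain of `L`. -/
def IsAdmissible (F : PseudoFinsler E M) (a b : ℝ) (γ : ℝ → M) : Prop :=
  ∀ t ∈ Icc a b, (⟨γ t, velocity (Icc a b) γ t⟩ : TangentBundle 𝓘(ℝ, E) M) ∈ F.A

/-- `γ : [a, b] → M` is a geodesic: smooth, `L`-admissible, and `D^{γ̇}_γ γ̇ = 0`. -/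
structure IsGeodesic (F : PseudoFinsler E M) (a b : ℝ) (γ : ℝ → M) : Prop where
  smooth : ContMDiffOn 𝓘(ℝ, ℝ) 𝓘(ℝ, E) ∞ γ (Icc a b)
  admissible : F.IsAdmissible a b γ
  parallel : ∀ t ∈ Icc a b,
    F.covDeriv (Icc a b) γ (velocity (Icc a b) γ) (velocity (Icc a b) γ) t = 0

/-- `Λ : [a, b] × (-ε, ε) → M`, `(t, s) ↦ Λ t s`, is a smooth two-parameter map. -/
def IsSmoothVariation (E : Type*) [NormedAddCommGroup E] [NormedSpace ℝ E]
    {M : Type*} [TopologicalSpace M] [ChartedSpace E M]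
    (a b ε : ℝ) (Λ : ℝ → ℝ → M) : Prop :=
  ContMDiffOn 𝓘(ℝ, ℝ × ℝ) 𝓘(ℝ, E) ∞ (fun q : ℝ × ℝ => Λ q.1 q.2) (Icc a b ×ˢ Ioo (-ε) ε)

/-- `Λ_t(t, s)`: the velocity at `t` of the longitudinal curve `t ↦ Λ t s`. -/
def velT (a b : ℝ) (Λ : ℝ → ℝ → M) (t s : ℝ) : TangentSpace 𝓘(ℝ, E) (Λ t s) :=
  velocity (Icc a b) (fun τ => Λ τ s) t

/-- `Λ_s(t, s)`: the velocity at `s` of the transverse curve `s ↦ Λ t s`. -/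
def velS (ε : ℝ) (Λ : ℝ → ℝ → M) (t s : ℝ) : TangentSpace 𝓘(ℝ, E) (Λ t s) :=
  velocity (Ioo (-ε) ε) (fun σ => Λ t σ) s

/-- `D^{Λ_t}_{γ_s} Z`, the covariant derivative along the longitudinal curves. -/
def covT (F : PseudoFinsler E M) (a b : ℝ) (Λ : ℝ → ℝ → M)
    (Z : ∀ t s, TangentSpace 𝓘(ℝ, E) (Λ t s)) (t s : ℝ) : TangentSpace 𝓘(ℝ, E) (Λ t s) :=
  F.covDeriv (Icc a b) (fun τ => Λ τ s) (fun τ => velT a b Λ τ s) (fun τ => Z τ s) t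

/-- `D^{Λ_t}_{β_t} Z`, the covariant derivative along the transverse curves. -/
def covS (F : PseudoFinsler E M) (a b ε : ℝ) (Λ : ℝ → ℝ → M)
    (Z : ∀ t s, TangentSpace 𝓘(ℝ, E) (Λ t s)) (t s : ℝ) : TangentSpace 𝓘(ℝ, E) (Λ t s) :=
  F.covDeriv (Ioo (-ε) ε) (fun σ => Λ t σ) (fun σ => velT a b Λ t σ) (fun σ => Z t σ) s

/-- `R^Λ(Z) = D^{Λ_t}_{γ_s} D^{Λ_t}_{β_t} Z - D^{Λ_t}_{β_t} D^{Λ_t}_{γ_s} Z`. -/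
def curvatureVar (F : PseudoFinsler E M) (a b ε : ℝ) (Λ : ℝ → ℝ → M)
    (Z : ∀ t s, TangentSpace 𝓘(ℝ, E) (Λ t s)) (t s : ℝ) : TangentSpace 𝓘(ℝ, E) (Λ t s) :=
  F.covT a b Λ (F.covS a b ε Λ Z) t s - F.covS a b ε Λ (F.covT a b Λ Z) t s

/-- `Λ` on `[a, b] × (-ε, ε)` is a smooth `L`-admissible variation of `γ` with variation vector
field `W`, and `Z'` is a smooth vector field along `Λ` that extends the field `Z` along `γ`.
Equality in the tangent bundle is equality of base points and of vectors. -/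
structure IsExtension (F : PseudoFinsler E M) (a b : ℝ) (γ : ℝ → M)
    (W Z : ∀ t, TangentSpace 𝓘(ℝ, E) (γ t)) (ε : ℝ) (Λ : ℝ → ℝ → M)
    (Z' : ∀ t s, TangentSpace 𝓘(ℝ, E) (Λ t s)) : Prop where
  pos : 0 < ε
  smooth : IsSmoothVariation E a b ε Λ
  admissible : ∀ s ∈ Ioo (-ε) ε, F.IsAdmissible a b (fun t => Λ t s)
  variationField : ∀ t ∈ Icc a b,
    (⟨Λ t 0, velS ε Λ t 0⟩ : TangentBundle 𝓘(ℝ, E) M) = ⟨γ t, W t⟩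
  smooth_field : ContMDiffOn 𝓘(ℝ, ℝ × ℝ) 𝓘(ℝ, E).tangent ∞
    (fun q : ℝ × ℝ => (⟨Λ q.1 q.2, Z' q.1 q.2⟩ : TangentBundle 𝓘(ℝ, E) M))
    (Icc a b ×ˢ Ioo (-ε) ε)
  extends_field : ∀ t ∈ Icc a b, (⟨Λ t 0, Z' t 0⟩ : TangentBundle 𝓘(ℝ, E) M) = ⟨γ t, Z t⟩

/-- `R^γ(γ̇, W) Z = Y` on `[a, b]`. The left side is `R^Λ(Z')` at `s = 0`, for any admissible
variation `Λ` of `γ` with variation vector field `W` and any extension `Z'` of `Z` to `Λ`. The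
predicate says that such `Λ` and `Z'` exist and that all of them give `Y`, so that it determines
`Y` on `[a, b]` and contains the independence of the choices. -/
def HasCurvatureAlong (F : PseudoFinsler E M) (a b : ℝ) (γ : ℝ → M)
    (W Z Y : ∀ t, TangentSpace 𝓘(ℝ, E) (γ t)) : Prop :=
  (∃ (ε : ℝ) (Λ : ℝ → ℝ → M) (Z' : ∀ t s, TangentSpace 𝓘(ℝ, E) (Λ t s)),
    F.IsExtension a b γ W Z ε Λ Z') ∧
  ∀ (ε : ℝ) (Λ : ℝ → ℝ → M) (Z' : ∀ t s, TangentSpace 𝓘(ℝ, E) (Λ t s)),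
    F.IsExtension a b γ W Z ε Λ Z' → ∀ t ∈ Icc a b,
      (⟨Λ t 0, F.curvatureVar a b ε Λ Z' t 0⟩ : TangentBundle 𝓘(ℝ, E) M) = ⟨γ t, Y t⟩

/-- `J' = D^{γ̇}_γ J` for a field `J` along `γ : [a, b] → M`. -/
def covPrime (F : PseudoFinsler E M) (a b : ℝ) (γ : ℝ → M)
    (J : ∀ t, TangentSpace 𝓘(ℝ, E) (γ t)) (t : ℝ) : TangentSpace 𝓘(ℝ, E) (γ t) :=
  F.covDeriv (Icc a b) γ (velocity (Icc a b) γ) J t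

/-- `J` is a Jacobi field of the geodesic `γ : [a, b] → M`: a smooth field along `γ` with
`J'' = R^γ(γ̇, J) γ̇`. -/
structure IsJacobiField (F : PseudoFinsler E M) (a b : ℝ) (γ : ℝ → M)
    (J : ∀ t, TangentSpace 𝓘(ℝ, E) (γ t)) : Prop where
  geodesic : F.IsGeodesic a b γ
  smooth : IsSmoothFieldAlong a b γ J
  jacobi : F.HasCurvatureAlong a b γ J (velocity (Icc a b) γ)
    (F.covPrime a b γ (F.covPrime a b γ J))

end

end PseudoFinsler

end

/-! Write `D_t`, `D_s` for the covariant derivatives along the two families of curves, both with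
reference field `Λ_t`. Torsion-freeness gives `D_t Λ_s = D_s Λ_t`, hence `D_t D_t Λ_s = D_t D_s
Λ_t`. This is the commutator `R(Λ_t)` plus `D_s D_t Λ_t`, and the last term vanishes because every
longitudinal curve is a geodesic. At `s = 0` this is the Jacobi equation. The ingredients are
`covT_velS` and `covS_eq_zero`.

Most of the work makes these symbols meaningful. Independence of the choices is a computation in one
chart: by `commutator_eq_localCurvature`, the derivatives of the extended field cancel. What remains
depends only on the position, velocity and acceleration of `γ`, on the components of the variation
field and their `t`-derivative, and on the values of the field along `γ`. All of these are fixed by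
the data along `γ`.

That computation needs a fixed chart, whereas `covDeriv` uses the preferred chart of each point of
the curve. The passage between the two is `covDerivInChart_change`, which rests on the
transformation law `localChristoffel_change`. The law is not computed from the explicit Koszul
formula. The transformed symbols satisfy the two axioms of the Chern connection, and `eq_of_koszul`
shows that these axioms have only one solution. The facts about the Cartan tensor that enter are its
total symmetry and `C_v(v, ·, ·) = 0`, the latter by homogeneity. -/

noncomputable section

set_option maxSynthPendingDepth 3
set_option linter.unusedSectionVars false

/-! ### Linear algebra of the Chern connection: uniqueness, linearity, smooth dependence. -/

namespace ChernAlgebra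

section

variable {E : Type*} [NormedAddCommGroup E] [NormedSpace ℝ E]

/-- The two axioms of the Chern connection determine its Christoffel symbols. -/
theorem eq_of_koszul {g : E →L[ℝ] E →L[ℝ] ℝ} {C : E →L[ℝ] E →L[ℝ] E →L[ℝ] ℝ} {v : E}
    {T : E → E → E → ℝ} {Γ Γ' : E → E → E}
    (hg : ∀ u w, g u w = g w u) (hinj : ∀ u, (∀ w, g u w = 0) → u = 0)
    (hC₁ : ∀ z u w, C z u w = C z w u) (hC₂ : ∀ z u w, C z u w = C u z w)
    (hCv : ∀ u w, C v u w = 0)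
    (hs : ∀ u w, Γ u w = Γ w u) (hs' : ∀ u w, Γ' u w = Γ' w u)
    (h : ∀ u w z, T u w z = g (Γ u w) z + g w (Γ u z) + 2 * C (Γ u v) w z)
    (h' : ∀ u w z, T u w z = g (Γ' u w) z + g w (Γ' u z) + 2 * C (Γ' u v) w z) (u w : E) :
    Γ u w = Γ' u w := by
  set Δ : E → E → E := fun u w => Γ u w - Γ' u w with hΔ
  have hsΔ : ∀ u w, Δ u w = Δ w u := fun u w => by simp only [hΔ, hs u w, hs' u w]
  have hK : ∀ u w z, g (Δ u w) z + g (Δ u z) w + 2 * C (Δ u v) w z = 0 := by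
    intro u w z
    have h1 := h u w z
    have h2 := h' u w z
    simp only [hΔ, map_sub, sub_apply]
    rw [hg w] at h1 h2
    linarith
  -- The Koszul trick: add the relations for `(u, w, z)` and `(w, u, z)`, subtract the one for `(z,
  -- u, w)`. The Cartan terms still contain `Δ`, but only in the form `Δ · v`.
  have key : ∀ u w z, g (Δ u w) z
      = - (C (Δ u v) w z + C (Δ w v) u z - C (Δ z v) u w) := by
    intro u w z
    have h1 := hK u w z
    have h2 := hK w u z
    have h3 := hK z u w
    rw [hsΔ w u] at h2
    rw [hsΔ z u, hsΔ z w] at h3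
    linarith
  have hCv₁ : ∀ u w, C u v w = 0 := fun u w => by rw [hC₂, hCv]
  have hCv₂ : ∀ u w, C u w v = 0 := fun u w => by rw [hC₁, hCv₁]
  -- Because `C` vanishes when an argument is `v`, the right side of `key` dies in three stages:
  -- first both slots equal to `v`, then one slot, then none.
  have e1 : Δ v v = 0 := hinj _ fun z => by rw [key, hCv₁, hCv₁]; simp
  have e2 : ∀ u, Δ u v = 0 := fun u => hinj _ fun z => by
    rw [key, hCv₁, e1, hCv₂]; simp
  have e3 : Δ u w = 0 := hinj _ fun z => by
    rw [key, e2, e2, e2]; simp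
  exact sub_eq_zero.1 e3

variable (g : E →L[ℝ] E →L[ℝ] ℝ) (T C : E →L[ℝ] E →L[ℝ] E →L[ℝ] ℝ) (v : E)

/-- Needs no invertibility of `g`, since `ContinuousLinearMap.inverse g` is linear in every case.
The first slot receives the differentiated field, so its linearity is what lets the derivatives of
the field cancel in the commutator. -/
theorem christoffel_add_left (u u' w : E) :
    christoffel g T C v (u + u') w = christoffel g T C v u w + christoffel g T C v u' w := by
  simp only [christoffel, map_add, add_apply, ContinuousLinearMap.add_comp, map_sub]
  abel

theorem christoffel_smul_left (r : ℝ) (u w : E) :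
    christoffel g T C v (r • u) w = r • christoffel g T C v u w := by
  simp only [christoffel, map_add, smul_apply, map_smul, ContinuousLinearMap.smul_comp, map_sub,
    smul_add, smul_sub]

end

section Smooth

variable {E : Type*} [NormedAddCommGroup E] [NormedSpace ℝ E]
  {X : Type*} [NormedAddCommGroup X] [NormedSpace ℝ X] {n : ℕ∞ω} {x₀ : X}

theorem _root_.ContDiffAt.clm_flip {F G H : Type*} [NormedAddCommGroup F] [NormedSpace ℝ F]
    [NormedAddCommGroup G] [NormedSpace ℝ G] [NormedAddCommGroup H] [NormedSpace ℝ H]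
    {f : X → F →L[ℝ] G →L[ℝ] H} (hf : ContDiffAt ℝ n f x₀) :
    ContDiffAt ℝ n (fun x => (f x).flip) x₀ :=
  (ContinuousLinearMap.flipₗᵢ ℝ F G H).toContinuousLinearEquiv.contDiff.contDiffAt.comp x₀ hf

theorem contDiffAt_firstKind {T : X → E →L[ℝ] E →L[ℝ] E →L[ℝ] ℝ} {w : X → E}
    (hT : ContDiffAt ℝ n T x₀) (hw : ContDiffAt ℝ n w x₀) :
    ContDiffAt ℝ n (fun x => firstKind (T x) (w x)) x₀ := by
  unfold firstKind
  exact ContDiffAt.const_smul (1 / 2 : ℝ)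
    (((hT.clm_flip.clm_apply hw).add (hT.clm_apply hw)).sub (hT.clm_flip.clm_apply hw).clm_flip)

/-- The symbols are built from `g⁻¹`, `T` and `C` by application and composition; completeness and
invertibility at `x₀` make inversion smooth there. -/
theorem contDiffAt_christoffel [CompleteSpace E] {g : X → E →L[ℝ] E →L[ℝ] ℝ}
    {T C : X → E →L[ℝ] E →L[ℝ] E →L[ℝ] ℝ} {v u w : X → E} (hg : ContDiffAt ℝ n g x₀)
    (hT : ContDiffAt ℝ n T x₀) (hC : ContDiffAt ℝ n C x₀) (hv : ContDiffAt ℝ n v x₀)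
    (hu : ContDiffAt ℝ n u x₀) (hw : ContDiffAt ℝ n w x₀) (hinv : (g x₀).IsInvertible) :
    ContDiffAt ℝ n (fun x => christoffel (g x) (T x) (C x) (v x) (u x) (w x)) x₀ := by
  have hi : ContDiffAt ℝ n (fun x => ContinuousLinearMap.inverse (g x)) x₀ :=
    hinv.contDiffAt_map_inverse.comp x₀ hg
  have hspray : ContDiffAt ℝ n (fun x => spray (g x) (T x) (v x)) x₀ :=
    hi.clm_apply ((contDiffAt_firstKind hT hv).clm_apply hv)
  have hN : ContDiffAt ℝ n (fun x => nonlin (g x) (T x) (C x) (v x)) x₀ :=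
    hi.clm_comp ((contDiffAt_firstKind hT hv).sub (hC.clm_apply hspray))
  exact hi.clm_apply (((((contDiffAt_firstKind hT hw).clm_apply hu).sub
    ((hC.clm_apply hw).clm_apply (hN.clm_apply hu))).sub
    ((hC.clm_apply hu).clm_apply (hN.clm_apply hw))).add
    (((hC.clm_apply hu).clm_apply hw).clm_comp hN))

end Smooth

end ChernAlgebra

/-! ### The fundamental tensor, the Cartan tensor and the Christoffel symbols in natural
coordinates. -/

namespace PseudoFinsler

section

variable {E : Type*} [NormedAddCommGroup E] [NormedSpace ℝ E]
  {M : Type*} [TopologicalSpace M] [ChartedSpace E M] [IsManifold 𝓘(ℝ, E) ∞ M]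

/-- The tangent vector with natural coordinates `p` in the chart around `c`. -/
def tangentOfCoord (c : M) (p : E × E) : TangentBundle 𝓘(ℝ, E) M :=
  ⟨(extChartAt 𝓘(ℝ, E) c).symm p.1, ofCoord c ((extChartAt 𝓘(ℝ, E) c).symm p.1) p.2⟩

theorem symm_mem_chart_source {c : M} {x : E} (hx : x ∈ (extChartAt 𝓘(ℝ, E) c).target) :
    (extChartAt 𝓘(ℝ, E) c).symm x ∈ (chartAt E c).source := by
  simpa using (extChartAt 𝓘(ℝ, E) c).map_target hx

theorem contMDiffOn_tangentOfCoord (c : M) :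
    ContMDiffOn 𝓘(ℝ, E × E) 𝓘(ℝ, E).tangent ∞ (tangentOfCoord c)
      ((extChartAt 𝓘(ℝ, E) c).target ×ˢ univ) := by
  have h1 : ContMDiffOn 𝓘(ℝ, E × E) 𝓘(ℝ, E) ∞
      (fun p : E × E => (extChartAt 𝓘(ℝ, E) c).symm p.1)
      ((extChartAt 𝓘(ℝ, E) c).target ×ˢ univ) :=
    (contMDiffOn_extChartAt_symm c).comp contDiff_fst.contMDiff.contMDiffOn fun p hp => hp.1
  have h2 : ContMDiffOn 𝓘(ℝ, E × E) (𝓘(ℝ, E).prod 𝓘(ℝ, E)) ∞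
      (fun p : E × E => ((extChartAt 𝓘(ℝ, E) c).symm p.1, p.2))
      ((extChartAt 𝓘(ℝ, E) c).target ×ˢ univ) :=
    h1.prodMk contDiff_snd.contMDiff.contMDiffOn
  have h3 := ((trivializationAt E (TangentSpace 𝓘(ℝ, E)) c).contMDiffOn_symm (n := ∞)
    (IB := 𝓘(ℝ, E))).comp h2 
      fun p hp => ⟨symm_mem_chart_source (x := p.1) hp.1, trivial⟩
  exact h3.congr fun p hp => Bundle.Trivialization.mk_symm _
    (symm_mem_chart_source (x := p.1) hp.1) _

/-- The natural coordinates, in the chart around `c`, of the domain of `L`. -/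
def chartDomain (F : PseudoFinsler E M) (c : M) : Set (E × E) :=
  ((extChartAt 𝓘(ℝ, E) c).target ×ˢ univ) ∩ tangentOfCoord c ⁻¹' F.A

variable (F : PseudoFinsler E M) {c : M}

theorem isOpen_chartDomain : IsOpen (F.chartDomain c) :=
  (contMDiffOn_tangentOfCoord c).continuousOn.isOpen_inter_preimage
    ((isOpen_extChartAt_target c).prod isOpen_univ) F.isOpen_A

variable {F} {p : E × E}

theorem contDiffAt_localL (hp : p ∈ F.chartDomain c) :
    ContDiffAt ℝ ∞ (fun q : E × E => F.localL c q.1 q.2) p := by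
  have : ContMDiffOn 𝓘(ℝ, E × E) 𝓘(ℝ, ℝ) ∞ (F.L ∘ tangentOfCoord c) (F.chartDomain c) :=
    F.smooth_L.comp ((contMDiffOn_tangentOfCoord c).mono inter_subset_left) fun q hq => hq.2
  exact this.contDiffOn.contDiffAt (F.isOpen_chartDomain.mem_nhds hp)

/-- A fibre derivative of a smooth function of `(x, v)` is smooth. -/
theorem _root_.ContDiffAt.fderiv_snd {G H K : Type*} [NormedAddCommGroup G] [NormedSpace ℝ G]
    [NormedAddCommGroup H] [NormedSpace ℝ H] [NormedAddCommGroup K] [NormedSpace ℝ K]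
    {f : G → H → K} {p : G × H} (hf : ContDiffAt ℝ ∞ (fun q : G × H => f q.1 q.2) p) :
    ContDiffAt ℝ ∞ (fun q : G × H => fderiv ℝ (f q.1) q.2) p := by
  refine ContDiffAt.fderiv (n := ∞) (f := fun (q : G × H) v => f q.1 v) (g := Prod.snd) ?_
    contDiffAt_snd (by simp)
  exact ContDiffAt.comp (p, p.2) (g := fun q : G × H => f q.1 q.2)
    (f := fun q : (G × H) × H => (q.1.1, q.2)) hf (by fun_prop)

theorem _root_.ContDiffAt.fderiv_fst {G H K : Type*} [NormedAddCommGroup G] [NormedSpace ℝ G]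
    [NormedAddCommGroup H] [NormedSpace ℝ H] [NormedAddCommGroup K] [NormedSpace ℝ K]
    {f : G → H → K} {p : G × H} (hf : ContDiffAt ℝ ∞ (fun q : G × H => f q.1 q.2) p) :
    ContDiffAt ℝ ∞ (fun q : G × H => fderiv ℝ (fun x => f x q.2) q.1) p := by
  refine ContDiffAt.fderiv (n := ∞) (f := fun (q : G × H) x => f x q.2) (g := Prod.fst) ?_
    contDiffAt_fst (by simp)
  exact ContDiffAt.comp (p, p.1) (g := fun q : G × H => f q.1 q.2)
    (f := fun q : (G × H) × G => (q.2, q.1.2)) hf (by fun_prop)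

theorem contDiffAt_localMetric (hp : p ∈ F.chartDomain c) :
    ContDiffAt ℝ ∞ (fun q : E × E => F.localMetric c q.1 q.2) p :=
  ContDiffAt.const_smul (1 / 2 : ℝ) (ContDiffAt.fderiv_snd
    (f := fun x v => fderiv ℝ (F.localL c x) v) (contDiffAt_localL hp).fderiv_snd)

theorem contDiffAt_localCartan (hp : p ∈ F.chartDomain c) :
    ContDiffAt ℝ ∞ (fun q : E × E => F.localCartan c q.1 q.2) p :=
  ContDiffAt.const_smul (1 / 2 : ℝ) (contDiffAt_localMetric hp).fderiv_snd

theorem contDiffAt_localMetricDeriv (hp : p ∈ F.chartDomain c) :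
    ContDiffAt ℝ ∞ (fun q : E × E => F.localMetricDeriv c q.1 q.2) p :=
  (contDiffAt_localMetric hp).fderiv_fst

theorem contDiffAt_fibre {K : Type*} [NormedAddCommGroup K] [NormedSpace ℝ K] {f : E → E → K}
    {x v : E} (hf : ContDiffAt ℝ ∞ (fun q : E × E => f q.1 q.2) (x, v)) :
    ContDiffAt ℝ ∞ (f x) v :=
  ContDiffAt.comp v (g := fun q : E × E => f q.1 q.2) (f := fun v => (x, v)) hf (by fun_prop)

theorem contDiffAt_base {K : Type*} [NormedAddCommGroup K] [NormedSpace ℝ K] {f : E → E → K}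
    {x v : E} (hf : ContDiffAt ℝ ∞ (fun q : E × E => f q.1 q.2) (x, v)) :
    ContDiffAt ℝ ∞ (fun x => f x v) x :=
  ContDiffAt.comp x (g := fun q : E × E => f q.1 q.2) (f := fun x => (x, v)) hf (by fun_prop)

variable {x v : E}

theorem eventually_mem_chartDomain_fibre (h : (x, v) ∈ F.chartDomain c) :
    ∀ᶠ v' in nhds v, (x, v') ∈ F.chartDomain c :=
  (Continuous.prodMk_right x).continuousAt.eventually (F.isOpen_chartDomain.mem_nhds h)

theorem eventually_mem_chartDomain_base (h : (x, v) ∈ F.chartDomain c) :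
    ∀ᶠ x' in nhds x, (x', v) ∈ F.chartDomain c :=
  (Continuous.prodMk_left v).continuousAt.eventually (F.isOpen_chartDomain.mem_nhds h)

theorem localMetric_symm (h : (x, v) ∈ F.chartDomain c) (u w : E) :
    F.localMetric c x v u w = F.localMetric c x v w u := by
  have := (contDiffAt_fibre (contDiffAt_localL h)).isSymmSndFDerivAt
    (by simpa using ENat.LEInfty.out)
  simp only [localMetric, smul_apply]
  rw [this.eq u w]

theorem differentiableAt_localMetric_fibre (h : (x, v) ∈ F.chartDomain c) :
    DifferentiableAt ℝ (fun v' => F.localMetric c x v') v :=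
  (contDiffAt_fibre (contDiffAt_localMetric h)).differentiableAt (by simp)

theorem differentiableAt_localMetric_base (h : (x, v) ∈ F.chartDomain c) :
    DifferentiableAt ℝ (fun x' => F.localMetric c x' v) x :=
  (contDiffAt_base (contDiffAt_localMetric h)).differentiableAt (by simp)

/-- Symmetry of the second derivative of `v ↦ d_v L`. Together with the symmetry in the last two
slots, inherited from the metric, it makes the Cartan tensor totally symmetric. -/
theorem localCartan_symm (h : (x, v) ∈ F.chartDomain c) (z u w : E) :
    F.localCartan c x v z u w = F.localCartan c x v u z w := by
  have hs := (contDiffAt_fibre (f := fun x v => fderiv ℝ (F.localL c x) v)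
    (contDiffAt_localL h).fderiv_snd).isSymmSndFDerivAt
    (by simpa using ENat.LEInfty.out)
  have e : fderiv ℝ (fun v' => F.localMetric c x v') v
      = (1 / 2 : ℝ) • fderiv ℝ (fderiv ℝ (fun v => fderiv ℝ (F.localL c x) v)) v :=
    fderiv_fun_const_smul (c := (1 / 2 : ℝ)) (f := fderiv ℝ (fun v => fderiv ℝ (F.localL c x) v))
      ((contDiffAt_fibre (f := fun x v => fderiv ℝ (fun v => fderiv ℝ (F.localL c x) v) v)
        (ContDiffAt.fderiv_snd (f := fun x v => fderiv ℝ (F.localL c x) v)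
          (contDiffAt_localL h).fderiv_snd)).differentiableAt (by simp))
  simp only [localCartan, e, smul_apply]
  rw [hs.eq z u]

theorem hasFDerivAt_apply₂ {X : Type*} [NormedAddCommGroup X] [NormedSpace ℝ X]
    {g : X → E →L[ℝ] E →L[ℝ] ℝ} {g' : X →L[ℝ] E →L[ℝ] E →L[ℝ] ℝ} {p : X}
    (hg : HasFDerivAt g g' p) (u w : E) :
    HasFDerivAt (fun q => g q u w) ((g'.flip u).flip w) p := by
  have := (hg.clm_apply (hasFDerivAt_const u p)).clm_apply (hasFDerivAt_const w p)
  refine this.congr_fderiv ?_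
  ext; simp

theorem localCartan_symm' (h : (x, v) ∈ F.chartDomain c) (z u w : E) :
    F.localCartan c x v z u w = F.localCartan c x v z w u := by
  have hd := (differentiableAt_localMetric_fibre h).hasFDerivAt
  have h1 := hasFDerivAt_apply₂ hd u w
  have h2 := hasFDerivAt_apply₂ hd w u
  have := h1.unique (h2.congr_of_eventuallyEq
    ((eventually_mem_chartDomain_fibre h).mono fun v' hv' => localMetric_symm hv' u w))
  simpa [localCartan] using DFunLike.congr_fun this z

theorem localMetricDeriv_symm (h : (x, v) ∈ F.chartDomain c) (z u w : E) :
    F.localMetricDeriv c x v z u w = F.localMetricDeriv c x v z w u := by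
  have hd := (differentiableAt_localMetric_base h).hasFDerivAt
  have h1 := hasFDerivAt_apply₂ hd u w
  have h2 := hasFDerivAt_apply₂ hd w u
  have := h1.unique (h2.congr_of_eventuallyEq
    ((eventually_mem_chartDomain_base h).mono fun v' hv' => localMetric_symm hv' u w))
  simpa [localMetricDeriv] using DFunLike.congr_fun this z

section Coord

variable {q : M}

theorem coordVec_ofCoord (hq : q ∈ (chartAt E c).source) (v : E) :
    coordVec c (ofCoord c q v) = v :=
  congrArg Prod.snd ((trivializationAt E (TangentSpace 𝓘(ℝ, E)) c).apply_mk_symm hq v)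

theorem ofCoord_coordVec (hq : q ∈ (chartAt E c).source) (v : TangentSpace 𝓘(ℝ, E) q) :
    ofCoord c q (coordVec c v) = v :=
  (trivializationAt E (TangentSpace 𝓘(ℝ, E)) c).symm_apply_apply_mk hq v

/-- A tangent vector at `q` is stored by its components in the preferred chart of `q`, so `coordVec
c` is by definition the linear map `tangentCoordChange` from that chart to the one around `c`. -/
theorem coordVec_add (v w : TangentSpace 𝓘(ℝ, E) q) :
    coordVec c (v + w) = coordVec c v + coordVec c w :=
  map_add (tangentCoordChange 𝓘(ℝ, E) q c q) v w

theorem coordVec_sub (v w : TangentSpace 𝓘(ℝ, E) q) :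
    coordVec c (v - w) = coordVec c v - coordVec c w :=
  map_sub (tangentCoordChange 𝓘(ℝ, E) q c q) v w

theorem coordVec_smul (r : ℝ) (v : TangentSpace 𝓘(ℝ, E) q) :
    coordVec c (r • v) = r • coordVec c v :=
  map_smul (tangentCoordChange 𝓘(ℝ, E) q c q) r v

theorem coordVec_zero : coordVec c (0 : TangentSpace 𝓘(ℝ, E) q) = 0 :=
  map_zero (tangentCoordChange 𝓘(ℝ, E) q c q)

theorem coordVec_injective (hq : q ∈ (chartAt E c).source) :
    Function.Injective (coordVec c : TangentSpace 𝓘(ℝ, E) q → E) :=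
  Function.LeftInverse.injective (ofCoord_coordVec hq)

theorem ofCoord_smul (hq : q ∈ (chartAt E c).source) (r : ℝ) (v : E) :
    ofCoord c q (r • v) = r • ofCoord c q v :=
  coordVec_injective hq (by rw [coordVec_smul, coordVec_ofCoord hq, coordVec_ofCoord hq])

theorem ofCoord_add (hq : q ∈ (chartAt E c).source) (v w : E) :
    ofCoord c q (v + w) = ofCoord c q v + ofCoord c q w :=
  coordVec_injective hq (by
    rw [coordVec_add, coordVec_ofCoord hq, coordVec_ofCoord hq, coordVec_ofCoord hq])

end Coord

theorem smul_mem_chartDomain (h : (x, v) ∈ F.chartDomain c) {r : ℝ} (hr : 0 < r) :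
    (x, r • v) ∈ F.chartDomain c := by
  refine ⟨⟨h.1.1, trivial⟩, ?_⟩
  have := F.smul_mem _ _ r hr h.2
  simpa only [tangentOfCoord, ofCoord_smul (symm_mem_chart_source h.1.1), mem_preimage] using this

theorem localL_smul (h : (x, v) ∈ F.chartDomain c) {r : ℝ} (hr : 0 < r) :
    F.localL c x (r • v) = r ^ 2 * F.localL c x v := by
  have := F.homogeneous _ _ r hr h.2
  simpa only [localL, ofCoord_smul (symm_mem_chart_source h.1.1)] using this

theorem fderiv_localL_smul (h : (x, v) ∈ F.chartDomain c) {r : ℝ} (hr : 0 < r) :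
    fderiv ℝ (F.localL c x) (r • v) = r • fderiv ℝ (F.localL c x) v := by
  have h1 : HasFDerivAt (fun v' => F.localL c x (r • v'))
      (r • fderiv ℝ (F.localL c x) (r • v)) v := by
    have := ((contDiffAt_fibre (contDiffAt_localL (smul_mem_chartDomain h hr))).differentiableAt
      (by simp)).hasFDerivAt.comp v ((hasFDerivAt_id v).const_smul r)
    refine this.congr_fderiv ?_
    ext; simp
  have h2 : HasFDerivAt (fun v' => F.localL c x (r • v'))
      (r ^ 2 • fderiv ℝ (F.localL c x) v) v := by
    have := ((contDiffAt_fibre (contDiffAt_localL h)).differentiableAt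
      (by simp)).hasFDerivAt.const_smul (r ^ 2)
    exact this.congr_of_eventuallyEq
      ((eventually_mem_chartDomain_fibre h).mono fun v' hv' => by simpa using localL_smul hv' hr)
  have := h1.unique h2
  rw [pow_two, mul_smul] at this
  exact smul_right_injective _ hr.ne' this

theorem localMetric_smul (h : (x, v) ∈ F.chartDomain c) {r : ℝ} (hr : 0 < r) :
    F.localMetric c x (r • v) = F.localMetric c x v := by
  set D := fun v => fderiv ℝ (F.localL c x) v with hD
  have hs : ∀ {v}, (x, v) ∈ F.chartDomain c → HasFDerivAt D (fderiv ℝ D v) v := fun h =>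
    ((contDiffAt_fibre (f := fun x v => fderiv ℝ (F.localL c x) v)
      (contDiffAt_localL h).fderiv_snd).differentiableAt (by simp)).hasFDerivAt
  have h1 : HasFDerivAt (fun v' => D (r • v')) (r • fderiv ℝ D (r • v)) v := by
    have := (hs (smul_mem_chartDomain h hr)).comp v ((hasFDerivAt_id v).const_smul r)
    refine this.congr_fderiv ?_
    ext; simp
  have h2 : HasFDerivAt (fun v' => D (r • v')) (r • fderiv ℝ D v) v :=
    ((hs h).const_smul r).congr_of_eventuallyEq
      ((eventually_mem_chartDomain_fibre h).mono fun v' hv' => by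
        simpa using fderiv_localL_smul hv' hr)
  rw [localMetric, localMetric, smul_right_injective _ hr.ne' (h1.unique h2)]

/-- Euler's relation: the metric is homogeneous of degree zero in the fibre, so `r ↦ g_{r v}` is
constant near `r = 1` and its derivative there is zero. -/
theorem localCartan_self (h : (x, v) ∈ F.chartDomain c) (u w : E) :
    F.localCartan c x v v u w = 0 := by
  have hd := (differentiableAt_localMetric_fibre h).hasFDerivAt
  have h0 : HasDerivAt (fun r : ℝ => r • v) v 1 := by
    simpa using (hasDerivAt_id (1 : ℝ)).smul_const v
  rw [← one_smul ℝ v] at hd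
  have h1 := hd.comp_hasDerivAt (1 : ℝ) h0
  have h2 : HasDerivAt ((fun v' => F.localMetric c x v') ∘ fun r : ℝ => r • v) 0 1 :=
    (hasDerivAt_const (1 : ℝ) (F.localMetric c x v)).congr_of_eventuallyEq
      ((lt_mem_nhds one_pos).mono fun r hr => localMetric_smul h hr)
  have := h1.unique h2
  rw [one_smul] at this
  simp [localCartan, this]

/-- Links the Fréchet derivatives used in charts to the iterated one-variable derivatives in which
nondegeneracy is assumed. The inner derivative is identified only for small `t`, where `v + t u`
stays in the open domain. -/
theorem localMetric_apply_eq_deriv (h : (x, v) ∈ F.chartDomain c) (u w : E) :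
    F.localMetric c x v u w = (1 / 2 : ℝ) * deriv (fun t : ℝ => deriv (fun s : ℝ =>
      F.localL c x (v + t • u + s • w)) 0) 0 := by
  set D := fun v => fderiv ℝ (F.localL c x) v with hD
  have hline : ∀ v u : E, HasDerivAt (fun t : ℝ => v + t • u) u 0 := fun v u => by
    simpa using ((hasDerivAt_id (0 : ℝ)).smul_const u).const_add v
  have h1 : ∀ {v}, (x, v) ∈ F.chartDomain c →
      deriv (fun s : ℝ => F.localL c x (v + s • w)) 0 = D v w := by
    intro v h
    have hd := ((contDiffAt_fibre (contDiffAt_localL h)).differentiableAt (by simp)).hasFDerivAt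
    exact HasDerivAt.deriv (hd.hasLineDerivAt w)
  have h2 : (fun t : ℝ => deriv (fun s : ℝ => F.localL c x (v + t • u + s • w)) 0)
      =ᶠ[nhds 0] fun t => D (v + t • u) w := by
    have hc : Filter.Tendsto (fun t : ℝ => v + t • u) (nhds 0) (nhds v) := by
      simpa using (hline v u).continuousAt.tendsto
    exact (hc.eventually (eventually_mem_chartDomain_fibre h)).mono fun t ht => h1 ht
  have hd := ((contDiffAt_fibre (f := fun x v => fderiv ℝ (F.localL c x) v)
    (contDiffAt_localL h).fderiv_snd).differentiableAt (by simp)).hasFDerivAt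
  have h3 : HasDerivAt (fun t : ℝ => D (v + t • u)) (fderiv ℝ D v u) 0 := hd.hasLineDerivAt u
  have h4 := (h3.clm_apply (hasDerivAt_const (0 : ℝ) w)).deriv
  rw [h2.deriv_eq, h4, map_zero, add_zero]
  rfl

theorem localMetric_nondegenerate (h : (x, v) ∈ F.chartDomain c) {u : E}
    (hu : ∀ w, F.localMetric c x v u w = 0) : u = 0 := by
  have hq := symm_mem_chart_source h.1.1
  have h0 : ofCoord c ((extChartAt 𝓘(ℝ, E) c).symm x) u = 0 := by
    refine F.nondegenerate _ _ h.2 _ fun w => ?_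
    refine Eq.trans ?_ (hu (coordVec c w))
    rw [localMetric_apply_eq_deriv h]
    simp only [localL, ofCoord_add hq, ofCoord_smul hq, ofCoord_coordVec hq]
  rw [← coordVec_ofCoord hq u, h0, coordVec_zero]

/-- The fundamental tensor in coordinates as an isomorphism onto the dual space. -/
theorem exists_localMetric_eq_equiv [FiniteDimensional ℝ E] (h : (x, v) ∈ F.chartDomain c) :
    ∃ e : E ≃L[ℝ] (E →L[ℝ] ℝ), (e : E →L[ℝ] E →L[ℝ] ℝ) = F.localMetric c x v := by
  have hfr : Module.finrank ℝ E = Module.finrank ℝ (E →L[ℝ] ℝ) := by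
    rw [← (LinearMap.toContinuousLinearMap (𝕜 := ℝ) (E := E) (F' := ℝ)).finrank_eq]
    exact (Subspace.dual_finrank_eq (K := ℝ) (V := E)).symm
  have hinj : Function.Injective (F.localMetric c x v : E →ₗ[ℝ] E →L[ℝ] ℝ) := by
    rw [injective_iff_map_eq_zero]
    exact fun u hu => localMetric_nondegenerate h fun w => DFunLike.congr_fun hu w
  refine ⟨(LinearMap.linearEquivOfInjective _ hinj hfr).toContinuousLinearEquiv, ?_⟩
  ext u w
  rfl

theorem isInvertible_localMetric [FiniteDimensional ℝ E] (h : (x, v) ∈ F.chartDomain c) :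
    (F.localMetric c x v).IsInvertible :=
  exists_localMetric_eq_equiv h

theorem localChristoffel_spec [FiniteDimensional ℝ E] (h : (x, v) ∈ F.chartDomain c) :
    (∀ u w, F.localChristoffel c x v u w = F.localChristoffel c x v w u) ∧
    ∀ u w z, F.localMetricDeriv c x v u w z
      = F.localMetric c x v (F.localChristoffel c x v u w) z
        + F.localMetric c x v w (F.localChristoffel c x v u z)
        + 2 * F.localCartan c x v (F.localChristoffel c x v u v) w z := by
  obtain ⟨e, he⟩ := exists_localMetric_eq_equiv h
  have he' : ∀ u, e u = F.localMetric c x v u := fun u => by rw [← he]; rfl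
  have := ChernAlgebra.christoffel_spec e (F.localMetricDeriv c x v) (F.localCartan c x v) v
    (fun u w => by rw [he', he', localMetric_symm h]) (localMetricDeriv_symm h)
    (localCartan_symm' h) (localCartan_symm h) (localCartan_self h)
  simp only [he, he'] at this
  exact this

theorem contDiffAt_localChristoffel [FiniteDimensional ℝ E] {u w : E}
    (h : (x, v) ∈ F.chartDomain c) :
    ContDiffAt ℝ ∞ (fun q : E × E × E × E => F.localChristoffel c q.1 q.2.1 q.2.2.1 q.2.2.2)
      (x, v, u, w) := by
  have hc : ∀ {K : Type _} [NormedAddCommGroup K] [NormedSpace ℝ K] {f : E → E → K},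
      ContDiffAt ℝ ∞ (fun q : E × E => f q.1 q.2) (x, v) →
      ContDiffAt ℝ ∞ (fun q : E × E × E × E => f q.1 q.2.1) (x, v, u, w) := fun hf =>
    hf.comp (x, v, u, w) (f := fun q : E × E × E × E => (q.1, q.2.1)) (by fun_prop)
  have := FiniteDimensional.complete ℝ E
  exact ChernAlgebra.contDiffAt_christoffel (hc (contDiffAt_localMetric h))
    (hc (contDiffAt_localMetricDeriv h)) (hc (contDiffAt_localCartan h)) (by fun_prop)
    (by fun_prop) (by fun_prop) (isInvertible_localMetric h)

end

end PseudoFinsler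

/-! ### Behaviour of these objects under a change of charts. -/

namespace PseudoFinsler

section

variable {E : Type*} [NormedAddCommGroup E] [NormedSpace ℝ E]
  {M : Type*} [TopologicalSpace M] [ChartedSpace E M] [IsManifold 𝓘(ℝ, E) ∞ M]

/-- The transition map from the chart around `c` to the chart around `c'`. -/
def chartChange (c c' : M) : E → E := extChartAt 𝓘(ℝ, E) c' ∘ (extChartAt 𝓘(ℝ, E) c).symm

/-- The domain of `chartChange c c'`. -/
def chartOverlap (c c' : M) : Set E :=
  ((extChartAt 𝓘(ℝ, E) c).symm ≫ extChartAt 𝓘(ℝ, E) c').source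

variable {c c' q : M}

theorem mem_chartOverlap {x : E} : x ∈ (chartOverlap c c' : Set E) ↔
    x ∈ (extChartAt 𝓘(ℝ, E) c).target ∧
      (extChartAt 𝓘(ℝ, E) c).symm x ∈ (chartAt E c').source := by
  simp [chartOverlap, PartialEquiv.trans_source]

theorem extChartAt_mem_chartOverlap (hq : q ∈ (chartAt E c).source)
    (hq' : q ∈ (chartAt E c').source) : extChartAt 𝓘(ℝ, E) c q ∈ (chartOverlap c c' : Set E) := by
  rw [← extChartAt_source 𝓘(ℝ, E)] at hq
  exact mem_chartOverlap.2 ⟨(extChartAt 𝓘(ℝ, E) c).map_source hq,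
    by rwa [(extChartAt 𝓘(ℝ, E) c).left_inv hq]⟩

theorem isOpen_chartOverlap : IsOpen (chartOverlap c c' : Set E) := by
  have : (chartOverlap c c' : Set E) = (extChartAt 𝓘(ℝ, E) c).target ∩
      (extChartAt 𝓘(ℝ, E) c).symm ⁻¹' (chartAt E c').source := by
    ext x; exact mem_chartOverlap
  rw [this]
  exact (continuousOn_extChartAt_symm c).isOpen_inter_preimage (isOpen_extChartAt_target c)
    (chartAt E c').open_source

theorem contDiffAt_chartChange {x : E} (hx : x ∈ (chartOverlap c c' : Set E)) :
    ContDiffAt ℝ ∞ (chartChange c c' : E → E) x := by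
  have := contDiffWithinAt_ext_coord_change (I := 𝓘(ℝ, E)) (n := ∞) c' c hx
  simpa [chartChange, ContDiffAt] using this

theorem chartChange_extChartAt (hq : q ∈ (chartAt E c).source) :
    chartChange c c' (extChartAt 𝓘(ℝ, E) c q) = extChartAt 𝓘(ℝ, E) c' q := by
  rw [← extChartAt_source 𝓘(ℝ, E)] at hq
  simp only [chartChange, Function.comp_apply, (extChartAt 𝓘(ℝ, E) c).left_inv hq]

theorem tangentCoordChange_eq_fderiv (c c' q : M) :
    tangentCoordChange 𝓘(ℝ, E) c c' q
      = fderiv ℝ (chartChange c c') (extChartAt 𝓘(ℝ, E) c q) := by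
  rw [tangentCoordChange_def, ← fderivWithin_univ]
  simp [chartChange]

/-- The components of a tangent vector transform by the derivative of the transition map. -/
theorem coordVec_change (hq : q ∈ (chartAt E c).source) (hq' : q ∈ (chartAt E c').source)
    (V : TangentSpace 𝓘(ℝ, E) q) :
    coordVec c' V = fderiv ℝ (chartChange c c') (extChartAt 𝓘(ℝ, E) c q) (coordVec c V) := by
  rw [← tangentCoordChange_eq_fderiv]
  -- The cocycle identity, starting from the preferred chart of `q` in which `V` is stored.
  refine (tangentCoordChange_comp (I := 𝓘(ℝ, E)) (w := q) (x := c) (y := c') (z := q)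
    (v := (show E from V)) ?_).symm
  simp only [extChartAt_source]
  exact ⟨⟨mem_chart_source E q, hq⟩, hq'⟩

theorem tangentOfCoord_coordVec (hq : q ∈ (chartAt E c).source) (V : TangentSpace 𝓘(ℝ, E) q) :
    tangentOfCoord c (extChartAt 𝓘(ℝ, E) c q, coordVec c V) = ⟨q, V⟩ := by
  have hq' := hq
  rw [← extChartAt_source 𝓘(ℝ, E)] at hq'
  simp only [tangentOfCoord]
  rw [(extChartAt 𝓘(ℝ, E) c).left_inv hq', ofCoord_coordVec hq]

theorem tangentOfCoord_change {x : E} (hx : x ∈ (chartOverlap c c' : Set E)) (v : E) :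
    tangentOfCoord c' (chartChange c c' x, fderiv ℝ (chartChange c c') x v)
      = tangentOfCoord c (x, v) := by
  obtain ⟨hx1, hx2⟩ := mem_chartOverlap.1 hx
  have hs := symm_mem_chart_source hx1
  have := coordVec_change hs hx2 (ofCoord c ((extChartAt 𝓘(ℝ, E) c).symm x) v)
  rw [coordVec_ofCoord hs, (extChartAt 𝓘(ℝ, E) c).right_inv hx1] at this
  rw [← this]
  exact tangentOfCoord_coordVec hx2 _

/-- By the cocycle identity, the coordinate change in the opposite direction is the inverse. -/
theorem exists_fderiv_chartChange_eq_equiv {x : E} (hx : x ∈ (chartOverlap c c' : Set E)) :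
    ∃ e : E ≃L[ℝ] E, (e : E →L[ℝ] E) = fderiv ℝ (chartChange c c') x := by
  obtain ⟨hx1, hx2⟩ := mem_chartOverlap.1 hx
  have hs := symm_mem_chart_source hx1
  set q := (extChartAt 𝓘(ℝ, E) c).symm x with hq
  have hxq : extChartAt 𝓘(ℝ, E) c q = x := (extChartAt 𝓘(ℝ, E) c).right_inv hx1
  refine ⟨ContinuousLinearEquiv.equivOfInverse (tangentCoordChange 𝓘(ℝ, E) c c' q)
    (tangentCoordChange 𝓘(ℝ, E) c' c q) (fun v => ?_) (fun v => ?_), ?_⟩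
  · rw [tangentCoordChange_comp, tangentCoordChange_self] <;> simp only [extChartAt_source]
    exacts [hs, ⟨⟨hs, hx2⟩, hs⟩]
  · rw [tangentCoordChange_comp, tangentCoordChange_self] <;> simp only [extChartAt_source]
    exacts [hx2, ⟨⟨hx2, hs⟩, hx2⟩]
  · rw [← hxq, ← tangentCoordChange_eq_fderiv]
    rfl

variable {F : PseudoFinsler E M} {x v : E}

theorem chartDomain_change (hx : x ∈ (chartOverlap c c' : Set E)) (h : (x, v) ∈ F.chartDomain c) :
    (chartChange c c' x, fderiv ℝ (chartChange c c') x v) ∈ F.chartDomain c' := by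
  obtain ⟨hx1, hx2⟩ := mem_chartOverlap.1 hx
  refine ⟨⟨(extChartAt 𝓘(ℝ, E) c').map_source (by rwa [extChartAt_source]), trivial⟩, ?_⟩
  rw [mem_preimage, tangentOfCoord_change hx]
  exact h.2

theorem localL_change (hx : x ∈ (chartOverlap c c' : Set E)) (v : E) :
    F.localL c x v = F.localL c' (chartChange c c' x) (fderiv ℝ (chartChange c c') x v) :=
  congrArg F.L (tangentOfCoord_change hx v).symm

/-- No differentiability is required: `fderiv` commutes with precomposition by a linear equivalence
even at its default value. The identity thus holds for all `v` and can be differentiated once more.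
-/
theorem fderiv_localL_change (hx : x ∈ (chartOverlap c c' : Set E)) (v : E) :
    fderiv ℝ (F.localL c x) v
      = (fderiv ℝ (F.localL c' (chartChange c c' x)) (fderiv ℝ (chartChange c c') x v)).comp
        (fderiv ℝ (chartChange c c') x) := by
  obtain ⟨e, he⟩ := exists_fderiv_chartChange_eq_equiv hx
  have : F.localL c x = F.localL c' (chartChange c c' x) ∘ e := by
    ext v
    rw [localL_change hx, ← he]
    rfl
  rw [this, e.comp_right_fderiv, ← he]
  rfl

theorem localMetric_change (hx : x ∈ (chartOverlap c c' : Set E)) (h : (x, v) ∈ F.chartDomain c)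
    (u w : E) :
    F.localMetric c x v u w = F.localMetric c' (chartChange c c' x)
      (fderiv ℝ (chartChange c c') x v) (fderiv ℝ (chartChange c c') x u)
      (fderiv ℝ (chartChange c c') x w) := by
  set A := fderiv ℝ (chartChange c c') x
  set D := fun v => fderiv ℝ (F.localL c' (chartChange c c' x)) v with hD
  have hd : HasFDerivAt D (fderiv ℝ D (A v)) (A v) :=
    ((contDiffAt_fibre (f := fun x v => fderiv ℝ (F.localL c' x) v)
      (contDiffAt_localL (chartDomain_change hx h)).fderiv_snd).differentiableAt (by simp)).hasFDerivAt
  have hA : HasFDerivAt (fun v => D (A v)) ((fderiv ℝ D (A v)).comp A) v :=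
    hd.comp v A.hasFDerivAt
  have h1 := hA.clm_comp (hasFDerivAt_const A v)
  have h2 : (fun v => fderiv ℝ (F.localL c x) v) = fun v => (D (A v)).comp A :=
    funext fun v => fderiv_localL_change hx v
  rw [localMetric, h2, h1.fderiv, localMetric]
  simp [hD]

theorem localCartan_change (hx : x ∈ (chartOverlap c c' : Set E)) (h : (x, v) ∈ F.chartDomain c)
    (z u w : E) :
    F.localCartan c x v z u w = F.localCartan c' (chartChange c c' x)
      (fderiv ℝ (chartChange c c') x v) (fderiv ℝ (chartChange c c') x z)
      (fderiv ℝ (chartChange c c') x u) (fderiv ℝ (chartChange c c') x w) := by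
  set A := fderiv ℝ (chartChange c c') x with hA
  have h1 := hasFDerivAt_apply₂ (differentiableAt_localMetric_fibre h).hasFDerivAt u w
  have h2 := (hasFDerivAt_apply₂ (differentiableAt_localMetric_fibre
    (chartDomain_change hx h)).hasFDerivAt (A u) (A w)).comp v A.hasFDerivAt
  have := h1.unique (h2.congr_of_eventuallyEq
    ((eventually_mem_chartDomain_fibre h).mono fun v' hv' => localMetric_change hx hv' u w))
  simpa [localCartan] using DFunLike.congr_fun this z

/-- The full derivative of the fundamental tensor in coordinates. -/
theorem hasFDerivAt_localMetric (h : (x, v) ∈ F.chartDomain c) :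
    HasFDerivAt (fun p : E × E => F.localMetric c p.1 p.2)
      ((F.localMetricDeriv c x v).coprod ((2 : ℝ) • F.localCartan c x v)) (x, v) := by
  have hd := ((contDiffAt_localMetric h).differentiableAt (by simp)).hasFDerivAt
  refine hd.congr_fderiv ?_
  have h1 := hd.comp (f := fun x => (x, v)) x ((hasFDerivAt_id x).prodMk (hasFDerivAt_const v x))
  have h2 := hd.comp (f := fun v => (x, v)) v ((hasFDerivAt_const x v).prodMk (hasFDerivAt_id v))
  have e1 : F.localMetricDeriv c x v = _ := h1.fderiv
  have e2 : F.localCartan c x v = (1 / 2 : ℝ) • _ := congrArg ((1 / 2 : ℝ) • ·) h2.fderiv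
  rw [e1, e2]
  refine ContinuousLinearMap.ext fun p => ?_
  rw [← Prod.fst_add_snd p]
  simp [← map_add]

/-- Differentiate the transformation law of the metric in `x` with `v` fixed. In the new chart the
reference vector `Dφ_x v` moves with `x`, which produces the Cartan term; the two metric terms come
from the moving arguments. -/
theorem localMetricDeriv_change (hx : x ∈ (chartOverlap c c' : Set E))
    (h : (x, v) ∈ F.chartDomain c) (z u w : E) :
    F.localMetricDeriv c x v z u w
      = F.localMetricDeriv c' (chartChange c c' x) (fderiv ℝ (chartChange c c') x v)
          (fderiv ℝ (chartChange c c') x z) (fderiv ℝ (chartChange c c') x u)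
          (fderiv ℝ (chartChange c c') x w)
        + 2 * F.localCartan c' (chartChange c c' x) (fderiv ℝ (chartChange c c') x v)
          (fderiv ℝ (fderiv ℝ (chartChange c c')) x z v) (fderiv ℝ (chartChange c c') x u)
          (fderiv ℝ (chartChange c c') x w)
        + F.localMetric c' (chartChange c c' x) (fderiv ℝ (chartChange c c') x v)
          (fderiv ℝ (fderiv ℝ (chartChange c c')) x z u) (fderiv ℝ (chartChange c c') x w)
        + F.localMetric c' (chartChange c c' x) (fderiv ℝ (chartChange c c') x v)
          (fderiv ℝ (chartChange c c') x u) (fderiv ℝ (fderiv ℝ (chartChange c c')) x z w) := by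
  set φ : E → E := chartChange c c' with hφ
  have hφc := contDiffAt_chartChange hx
  have hφd : HasFDerivAt φ (fderiv ℝ φ x) x := (hφc.differentiableAt (by simp)).hasFDerivAt
  have hAd : HasFDerivAt (fderiv ℝ φ) (fderiv ℝ (fderiv ℝ φ) x) x :=
    ((hφc.fderiv_right (m := ∞) (by simp)).differentiableAt (by simp)).hasFDerivAt
  have hAu : ∀ u, HasFDerivAt (fun x' => fderiv ℝ φ x' u) ((fderiv ℝ (fderiv ℝ φ) x).flip u) x := by
    intro u
    refine (hAd.clm_apply (hasFDerivAt_const u x)).congr_fderiv ?_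
    ext; simp
  have hG := (hasFDerivAt_localMetric (chartDomain_change hx h)).comp (f := fun x' => (φ x', fderiv ℝ φ x' v)) x
    (hφd.prodMk (hAu v))
  have h2 := (hG.clm_apply (hAu u)).clm_apply (hAu w)
  have h1 := hasFDerivAt_apply₂ (differentiableAt_localMetric_base h).hasFDerivAt u w
  have he : (fun x' => F.localMetric c x' v u w) =ᶠ[nhds x] _ :=
    ((eventually_mem_chartDomain_base h).and (isOpen_chartOverlap.mem_nhds hx)).mono
      fun x' hx' => localMetric_change hx'.2 hx'.1 u w
  have := DFunLike.congr_fun (h1.unique (h2.congr_of_eventuallyEq he)) z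
  simp only [Function.comp_apply, ContinuousLinearMap.flip_apply, ContinuousLinearMap.comp_apply,
    add_apply, ContinuousLinearMap.coprod_apply, ContinuousLinearMap.prod_apply, smul_apply,
    smul_eq_mul] at this
  rw [localMetricDeriv, this]
  ring

/-- Pull the right side back by `Dφ`. The result is symmetric since `D²φ` is, and its `D²φ` terms
match those of `localMetricDeriv_change`, so it obeys both axioms in the old chart and uniqueness
applies. -/
theorem localChristoffel_change [FiniteDimensional ℝ E] (hx : x ∈ (chartOverlap c c' : Set E))
    (h : (x, v) ∈ F.chartDomain c) (u w : E) :
    fderiv ℝ (chartChange c c') x (F.localChristoffel c x v u w)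
      = F.localChristoffel c' (chartChange c c' x) (fderiv ℝ (chartChange c c') x v)
          (fderiv ℝ (chartChange c c') x u) (fderiv ℝ (chartChange c c') x w)
        + fderiv ℝ (fderiv ℝ (chartChange c c')) x u w := by
  obtain ⟨e, he⟩ := exists_fderiv_chartChange_eq_equiv hx
  have hsymm : ∀ u w, fderiv ℝ (fderiv ℝ (chartChange c c' : E → E)) x u w
      = fderiv ℝ (fderiv ℝ (chartChange c c' : E → E)) x w u := fun u w =>
    ((contDiffAt_chartChange hx).isSymmSndFDerivAt (by simpa using ENat.LEInfty.out)).eq u w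
  have h' := chartDomain_change hx h
  obtain ⟨hs, hk⟩ := localChristoffel_spec h
  obtain ⟨hs', hk'⟩ := localChristoffel_spec h'
  have hD := localMetricDeriv_change hx h
  have hg := localMetric_change hx h
  have hC := localCartan_change hx h
  rw [← he] at hs' hk' hD hg hC ⊢
  simp only [ContinuousLinearEquiv.coe_coe] at hs' hk' hD hg hC ⊢
  refine e.eq_symm_apply.1 ?_
  refine ChernAlgebra.eq_of_koszul (g := F.localMetric c x v) (C := F.localCartan c x v) (v := v)
    (T := fun u w z => F.localMetricDeriv c x v u w z)
    (Γ' := fun u w => e.symm (F.localChristoffel c' (chartChange c c' x) (e v) (e u) (e w)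
      + fderiv ℝ (fderiv ℝ (chartChange c c')) x u w))
    (localMetric_symm h) (fun u => localMetric_nondegenerate h) (localCartan_symm' h)
    (localCartan_symm h) (localCartan_self h) hs (fun u w => ?_) hk (fun u w z => ?_) u w
  · simp only [hs' (e u), hsymm u]
  · simp only [hD, hk', hg, hC, ContinuousLinearEquiv.apply_symm_apply, map_add, add_apply]
    ring

end

end PseudoFinsler

/-! ### Chart independence of the covariant derivative. -/

namespace PseudoFinsler

section

variable {E : Type*} [NormedAddCommGroup E] [NormedSpace ℝ E]
  {M : Type*} [TopologicalSpace M] [ChartedSpace E M] [IsManifold 𝓘(ℝ, E) ∞ M]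
  {c c' : M} {S : Set ℝ} {γ : ℝ → M} {t : ℝ}

theorem hasDerivWithinAt_extChartAt_comp
    (hγ : MDifferentiableWithinAt 𝓘(ℝ, ℝ) 𝓘(ℝ, E) γ S t) (hq : γ t ∈ (chartAt E c).source) :
    HasDerivWithinAt (fun τ => extChartAt 𝓘(ℝ, E) c (γ τ))
      (coordVec c (velocity (E := E) S γ t)) S t := by
  have h1 : HasMFDerivAt 𝓘(ℝ, E) 𝓘(ℝ, E) (extChartAt 𝓘(ℝ, E) c) (γ t)
      (mfderiv 𝓘(ℝ, E) 𝓘(ℝ, E) (extChartAt 𝓘(ℝ, E) c) (γ t)) :=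
    (mdifferentiableAt_extChartAt hq).hasMFDerivAt
  let L : ℝ →L[ℝ] E := (mfderiv 𝓘(ℝ, E) 𝓘(ℝ, E) (extChartAt 𝓘(ℝ, E) c) (γ t)).comp
    (mfderivWithin 𝓘(ℝ, ℝ) 𝓘(ℝ, E) γ S t)
  have h2 : HasFDerivWithinAt (fun τ => extChartAt 𝓘(ℝ, E) c (γ τ)) L S t :=
    (h1.comp_hasMFDerivWithinAt t hγ.hasMFDerivWithinAt).hasFDerivWithinAt
  refine h2.hasDerivWithinAt.congr_deriv ?_
  change mfderiv 𝓘(ℝ, E) 𝓘(ℝ, E) (extChartAt 𝓘(ℝ, E) c) (γ t) (velocity (E := E) S γ t) = _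
  -- The derivative of the chart at `γ t` is the fibre map of the tangent bundle trivialization,
  -- that is `coordVec c`.
  rw [← TangentBundle.continuousLinearMapAt_trivializationAt hq]
  exact congrFun ((trivializationAt E (TangentSpace 𝓘(ℝ, E)) c).coe_continuousLinearEquivAt_eq
    (R := ℝ) hq).symm _

theorem coordVec_velocity (hγ : MDifferentiableWithinAt 𝓘(ℝ, ℝ) 𝓘(ℝ, E) γ S t)
    (hu : UniqueDiffWithinAt ℝ S t) (hq : γ t ∈ (chartAt E c).source) :
    coordVec c (velocity (E := E) S γ t)
      = derivWithin (fun τ => extChartAt 𝓘(ℝ, E) c (γ τ)) S t :=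
  ((hasDerivWithinAt_extChartAt_comp hγ hq).derivWithin hu).symm

variable {F : PseudoFinsler E M} {W X : ∀ t, TangentSpace 𝓘(ℝ, E) (γ t)}

theorem mem_chartDomain {q : M} {V : TangentSpace 𝓘(ℝ, E) q} (hq : q ∈ (chartAt E c).source)
    (hV : (⟨q, V⟩ : TangentBundle 𝓘(ℝ, E) M) ∈ F.A) :
    (extChartAt 𝓘(ℝ, E) c q, coordVec c V) ∈ F.chartDomain c := by
  refine ⟨⟨(extChartAt 𝓘(ℝ, E) c).map_source (by rwa [extChartAt_source]), trivial⟩, ?_⟩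
  rwa [mem_preimage, tangentOfCoord_coordVec hq]

theorem _root_.HasFDerivAt.hasDerivWithinAt_clm_apply {A : E → E →L[ℝ] E}
    {A' : E →L[ℝ] E →L[ℝ] E} {x z : ℝ → E} {x' z' : E} (hA : HasFDerivAt A A' (x t))
    (hx : HasDerivWithinAt x x' S t) (hz : HasDerivWithinAt z z' S t) :
    HasDerivWithinAt (fun τ => A (x τ) (z τ)) (A' x' (z t) + A (x t) z') S t :=
  (hA.comp_hasDerivWithinAt t hx).clm_apply hz

/-- The covariant derivative does not depend on the chart in which it is computed. -/
theorem covDerivInChart_change [FiniteDimensional ℝ E]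
    (hγ : MDifferentiableWithinAt 𝓘(ℝ, ℝ) 𝓘(ℝ, E) γ S t) (hu : UniqueDiffWithinAt ℝ S t)
    (hq : γ t ∈ (chartAt E c).source) (hq' : γ t ∈ (chartAt E c').source)
    (hW : (⟨γ t, W t⟩ : TangentBundle 𝓘(ℝ, E) M) ∈ F.A)
    (hX : DifferentiableWithinAt ℝ (fun τ => coordVec c (X τ)) S t) :
    F.covDerivInChart c' S γ W X t = F.covDerivInChart c S γ W X t := by
  have hx : extChartAt 𝓘(ℝ, E) c (γ t) ∈ (chartOverlap c c' : Set E) :=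
    extChartAt_mem_chartOverlap hq hq'
  have hφ := contDiffAt_chartChange hx
  have hA : HasFDerivAt (fderiv ℝ (chartChange c c' : E → E))
      (fderiv ℝ (fderiv ℝ (chartChange c c')) (extChartAt 𝓘(ℝ, E) c (γ t)))
      (extChartAt 𝓘(ℝ, E) c (γ t)) :=
    ((hφ.fderiv_right (m := ∞) (by simp)).differentiableAt (by simp)).hasFDerivAt
  have hd := HasFDerivAt.hasDerivWithinAt_clm_apply (x := fun τ => extChartAt 𝓘(ℝ, E) c (γ τ))
    hA (hasDerivWithinAt_extChartAt_comp hγ hq) hX.hasDerivWithinAt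
  have he : (fun τ => coordVec c' (X τ)) =ᶠ[nhdsWithin t S] fun τ =>
      fderiv ℝ (chartChange c c') (extChartAt 𝓘(ℝ, E) c (γ τ)) (coordVec c (X τ)) :=
    ((hγ.continuousWithinAt.eventually ((chartAt E c).open_source.mem_nhds hq)).and
      (hγ.continuousWithinAt.eventually ((chartAt E c').open_source.mem_nhds hq'))).mono
        fun τ hτ => coordVec_change hτ.1 hτ.2 (X τ)
  -- The product rule leaves `D²φ(γ̇, X)`, which is exactly the inhomogeneous term of
  -- `localChristoffel_change` after exchanging its arguments.
  have hd' := (hd.congr_of_eventuallyEq he (coordVec_change hq hq' (X t))).derivWithin hu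
  have hs := hφ.isSymmSndFDerivAt (by simpa using ENat.LEInfty.out)
  refine coordVec_injective hq' ?_
  rw [covDerivInChart, covDerivInChart, coordVec_ofCoord hq',
    coordVec_change hq hq' (ofCoord c (γ t) _), coordVec_ofCoord hq, hd', map_add, localChristoffel_change hx (mem_chartDomain hq hW),
    chartChange_extChartAt hq, coordVec_change hq hq' (W t), coordVec_change hq hq' (X t),
    coordVec_change hq hq' (velocity S γ t), hs.eq]
  abel

/-- The chart in the definition of `covDeriv` varies with `t`. With `c` fixed, the formula holds at
all nearby parameters and can itself be differentiated. -/
theorem coordVec_covDeriv [FiniteDimensional ℝ E]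
    (hγ : MDifferentiableWithinAt 𝓘(ℝ, ℝ) 𝓘(ℝ, E) γ S t) (hu : UniqueDiffWithinAt ℝ S t)
    (hq : γ t ∈ (chartAt E c).source) (hW : (⟨γ t, W t⟩ : TangentBundle 𝓘(ℝ, E) M) ∈ F.A)
    (hX : DifferentiableWithinAt ℝ (fun τ => coordVec c (X τ)) S t) :
    coordVec c (F.covDeriv S γ W X t) = derivWithin (fun τ => coordVec c (X τ)) S t
      + F.localChristoffel c (extChartAt 𝓘(ℝ, E) c (γ t)) (coordVec c (W t)) (coordVec c (X t))
          (derivWithin (fun τ => extChartAt 𝓘(ℝ, E) c (γ τ)) S t) := by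
  rw [covDeriv, covDerivInChart_change hγ hu hq (mem_chart_source E (γ t)) hW hX, covDerivInChart,
    coordVec_ofCoord hq, coordVec_velocity hγ hu hq]

end

end PseudoFinsler

/-! ### Partial derivatives within a product of sets, boundary points included. -/

section PartialDerivatives

variable {E : Type*} [NormedAddCommGroup E] [NormedSpace ℝ E] {S T : Set ℝ} {f : ℝ → ℝ → E}
  {t s : ℝ}

theorem ContDiffWithinAt.eventually_hasDerivWithinAt_fst
    (hf : ContDiffWithinAt ℝ ∞ (fun q : ℝ × ℝ => f q.1 q.2) (S ×ˢ T) (t, s))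
    (h : (t, s) ∈ S ×ˢ T) : ∀ᶠ q in nhdsWithin (t, s) (S ×ˢ T),
      HasDerivWithinAt (fun τ => f τ q.2)
        (fderivWithin ℝ (fun q : ℝ × ℝ => f q.1 q.2) (S ×ˢ T) q (1, 0)) S q.1 := by
  -- Only finite order of smoothness at a point spreads to a neighbourhood; order one is enough
  -- here.
  have h1 := (hf.of_le (m := 1) ENat.LEInfty.out).eventually (by simp)
  rw [insert_eq_of_mem h] at h1
  filter_upwards [h1, self_mem_nhdsWithin] with q hq hqm
  have hd := (hq.differentiableWithinAt (by simp)).hasFDerivWithinAt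
  have hl : HasDerivWithinAt (fun τ : ℝ => (τ, q.2)) ((1 : ℝ), (0 : ℝ)) S q.1 :=
    (hasDerivWithinAt_id q.1 S).prodMk (hasDerivWithinAt_const q.1 S q.2)
  exact hd.comp_hasDerivWithinAt (t := S ×ˢ T) q.1 hl fun τ hτ => ⟨hτ, hqm.2⟩

theorem ContDiffWithinAt.eventually_hasDerivWithinAt_snd
    (hf : ContDiffWithinAt ℝ ∞ (fun q : ℝ × ℝ => f q.1 q.2) (S ×ˢ T) (t, s))
    (h : (t, s) ∈ S ×ˢ T) : ∀ᶠ q in nhdsWithin (t, s) (S ×ˢ T),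
      HasDerivWithinAt (fun σ => f q.1 σ)
        (fderivWithin ℝ (fun q : ℝ × ℝ => f q.1 q.2) (S ×ˢ T) q (0, 1)) T q.2 := by
  have h1 := (hf.of_le (m := 1) ENat.LEInfty.out).eventually (by simp)
  rw [insert_eq_of_mem h] at h1
  filter_upwards [h1, self_mem_nhdsWithin] with q hq hqm
  have hd := (hq.differentiableWithinAt (by simp)).hasFDerivWithinAt
  have hl : HasDerivWithinAt (fun σ : ℝ => (q.1, σ)) ((0 : ℝ), (1 : ℝ)) T q.2 :=
    (hasDerivWithinAt_const q.2 T q.1).prodMk (hasDerivWithinAt_id q.2 T)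
  exact hd.comp_hasDerivWithinAt (t := S ×ˢ T) q.2 hl fun σ hσ => ⟨hqm.1, hσ⟩

theorem ContDiffWithinAt.eventually_derivWithin_fst_eq (hS : UniqueDiffOn ℝ S)
    (hf : ContDiffWithinAt ℝ ∞ (fun q : ℝ × ℝ => f q.1 q.2) (S ×ˢ T) (t, s))
    (h : (t, s) ∈ S ×ˢ T) :
    (fun q : ℝ × ℝ => derivWithin (fun τ => f τ q.2) S q.1) =ᶠ[nhdsWithin (t, s) (S ×ˢ T)]
      fun q => fderivWithin ℝ (fun q : ℝ × ℝ => f q.1 q.2) (S ×ˢ T) q (1, 0) := by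
  filter_upwards [hf.eventually_hasDerivWithinAt_fst h, self_mem_nhdsWithin] with q hq hqm
  exact hq.derivWithin (hS _ hqm.1)

theorem ContDiffWithinAt.eventually_derivWithin_snd_eq (hT : UniqueDiffOn ℝ T)
    (hf : ContDiffWithinAt ℝ ∞ (fun q : ℝ × ℝ => f q.1 q.2) (S ×ˢ T) (t, s))
    (h : (t, s) ∈ S ×ˢ T) :
    (fun q : ℝ × ℝ => derivWithin (fun σ => f q.1 σ) T q.2) =ᶠ[nhdsWithin (t, s) (S ×ˢ T)]
      fun q => fderivWithin ℝ (fun q : ℝ × ℝ => f q.1 q.2) (S ×ˢ T) q (0, 1) := by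
  filter_upwards [hf.eventually_hasDerivWithinAt_snd h, self_mem_nhdsWithin] with q hq hqm
  exact hq.derivWithin (hT _ hqm.2)

theorem ContDiffWithinAt.derivWithin_fst (hS : UniqueDiffOn ℝ S) (hT : UniqueDiffOn ℝ T)
    (hf : ContDiffWithinAt ℝ ∞ (fun q : ℝ × ℝ => f q.1 q.2) (S ×ˢ T) (t, s))
    (h : (t, s) ∈ S ×ˢ T) :
    ContDiffWithinAt ℝ ∞ (fun q : ℝ × ℝ => derivWithin (fun τ => f τ q.2) S q.1)
      (S ×ˢ T) (t, s) :=
  ((hf.fderivWithin_right (m := ∞) (hS.prod hT) (by simp) h).clm_apply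
    contDiffWithinAt_const).congr_of_eventuallyEq_of_mem (hf.eventually_derivWithin_fst_eq hS h) h

theorem ContDiffWithinAt.derivWithin_snd (hS : UniqueDiffOn ℝ S) (hT : UniqueDiffOn ℝ T)
    (hf : ContDiffWithinAt ℝ ∞ (fun q : ℝ × ℝ => f q.1 q.2) (S ×ˢ T) (t, s))
    (h : (t, s) ∈ S ×ˢ T) :
    ContDiffWithinAt ℝ ∞ (fun q : ℝ × ℝ => derivWithin (fun σ => f q.1 σ) T q.2)
      (S ×ˢ T) (t, s) :=
  ((hf.fderivWithin_right (m := ∞) (hS.prod hT) (by simp) h).clm_apply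
    contDiffWithinAt_const).congr_of_eventuallyEq_of_mem (hf.eventually_derivWithin_snd_eq hT h) h

theorem tendsto_slice_fst (h : (t, s) ∈ S ×ˢ T) :
    Filter.Tendsto (fun τ : ℝ => (τ, s)) (nhdsWithin t S) (nhdsWithin (t, s) (S ×ˢ T)) :=
  (Continuous.prodMk_left s).continuousWithinAt.tendsto_nhdsWithin fun _ hτ => ⟨hτ, h.2⟩

theorem tendsto_slice_snd (h : (t, s) ∈ S ×ˢ T) :
    Filter.Tendsto (fun σ : ℝ => (t, σ)) (nhdsWithin s T) (nhdsWithin (t, s) (S ×ˢ T)) :=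
  (Continuous.prodMk_right t).continuousWithinAt.tendsto_nhdsWithin fun _ hσ => ⟨h.1, hσ⟩

theorem ContDiffWithinAt.hasDerivWithinAt_fst
    (hf : ContDiffWithinAt ℝ ∞ (fun q : ℝ × ℝ => f q.1 q.2) (S ×ˢ T) (t, s))
    (h : (t, s) ∈ S ×ˢ T) :
    HasDerivWithinAt (fun τ => f τ s) (_root_.derivWithin (fun τ => f τ s) S t) S t :=
  ((hf.eventually_hasDerivWithinAt_fst h).self_of_nhdsWithin
    h).differentiableWithinAt.hasDerivWithinAt

theorem ContDiffWithinAt.hasDerivWithinAt_snd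
    (hf : ContDiffWithinAt ℝ ∞ (fun q : ℝ × ℝ => f q.1 q.2) (S ×ˢ T) (t, s))
    (h : (t, s) ∈ S ×ˢ T) :
    HasDerivWithinAt (fun σ => f t σ) (_root_.derivWithin (fun σ => f t σ) T s) T s :=
  ((hf.eventually_hasDerivWithinAt_snd h).self_of_nhdsWithin
    h).differentiableWithinAt.hasDerivWithinAt

/-- Mixed partial derivatives commute, also at boundary points of the domain. -/
theorem ContDiffWithinAt.derivWithin_comm (hS : UniqueDiffOn ℝ S) (hT : UniqueDiffOn ℝ T)
    (hf : ContDiffWithinAt ℝ ∞ (fun q : ℝ × ℝ => f q.1 q.2) (S ×ˢ T) (t, s))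
    (h : (t, s) ∈ S ×ˢ T) (hcl : (t, s) ∈ closure (interior (S ×ˢ T))) :
    _root_.derivWithin (fun τ => _root_.derivWithin (fun σ => f τ σ) T s) S t
      = _root_.derivWithin (fun σ => _root_.derivWithin (fun τ => f τ σ) S t) T s := by
  set f' := fderivWithin ℝ (fun q : ℝ × ℝ => f q.1 q.2) (S ×ˢ T)
  have hd := ((hf.fderivWithin_right (m := ∞) (hS.prod hT) (by simp) h).differentiableWithinAt
    (by simp)).hasFDerivWithinAt
  -- At an edge point the symmetry is a limit of interior symmetry, hence the use of `hcl`.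
  have hsymm := hf.isSymmSndFDerivWithinAt (by simpa using ENat.LEInfty.out) (hS.prod hT) hcl h
  have h1 : HasDerivWithinAt (fun τ => f' (τ, s)) (fderivWithin ℝ f' (S ×ˢ T) (t, s) (1, 0)) S t :=
    hd.comp_hasDerivWithinAt (t := S ×ˢ T) (f := fun τ => (τ, s)) t
      ((hasDerivWithinAt_id t S).prodMk (hasDerivWithinAt_const t S s)) fun τ hτ => ⟨hτ, h.2⟩
  have h2 : HasDerivWithinAt (fun σ => f' (t, σ)) (fderivWithin ℝ f' (S ×ˢ T) (t, s) (0, 1)) T s :=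
    hd.comp_hasDerivWithinAt (t := S ×ˢ T) (f := fun σ => (t, σ)) s
      ((hasDerivWithinAt_const s T t).prodMk (hasDerivWithinAt_id s T)) fun σ hσ => ⟨h.1, hσ⟩
  have h1' := (h1.clm_apply (hasDerivWithinAt_const t S ((0 : ℝ), (1 : ℝ)))).derivWithin (hS _ h.1)
  have h2' := (h2.clm_apply (hasDerivWithinAt_const s T ((1 : ℝ), (0 : ℝ)))).derivWithin (hT _ h.2)
  have e1 := (tendsto_slice_fst h).eventually (hf.eventually_derivWithin_snd_eq hT h)
  have e2 := (tendsto_slice_snd h).eventually (hf.eventually_derivWithin_fst_eq hS h)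
  have e1' : (fun τ => _root_.derivWithin (fun σ => f τ σ) T s) =ᶠ[nhdsWithin t S]
      fun τ => f' (τ, s) (0, 1) := e1
  have e2' : (fun σ => _root_.derivWithin (fun τ => f τ σ) S t) =ᶠ[nhdsWithin s T]
      fun σ => f' (t, σ) (1, 0) := e2
  rw [e1'.derivWithin_eq (e1'.self_of_nhdsWithin h.1), e2'.derivWithin_eq
    (e2'.self_of_nhdsWithin h.2), h1', h2', map_zero, add_zero, add_zero]
  exact hsymm.eq (1, 0) (0, 1)

end PartialDerivatives

/-! ### The commutator of covariant derivatives in coordinates. -/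

namespace PseudoFinsler

section

variable {E : Type*} [NormedAddCommGroup E] [NormedSpace ℝ E] [FiniteDimensional ℝ E]
  {M : Type*} [TopologicalSpace M] [ChartedSpace E M] [IsManifold 𝓘(ℝ, E) ∞ M]
  (F : PseudoFinsler E M) (c : M)

/-- The Christoffel symbols in the chart around `c`, as a function of all their arguments. -/
def christoffelMap (q : E × E × E × E) : E := F.localChristoffel c q.1 q.2.1 q.2.2.1 q.2.2.2

/-- The curvature operator in the chart around `c`, in terms of the position `x`, the velocity `v`
and the acceleration `a` of a curve, of the components `y` of a variation field and of their
derivative `y'`, and of the components `z` of the field to which it is applied. -/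
def localCurvature (x v a z y y' : E) : E :=
  (fderiv ℝ (F.christoffelMap c) (x, v, z, y) (v, a, 0, y')
      + F.localChristoffel c x v (F.localChristoffel c x v z y) v)
    - (fderiv ℝ (F.christoffelMap c) (x, v, z, v) (y, y', 0, y')
      + F.localChristoffel c x v (F.localChristoffel c x v z v) y)

variable {F c}

theorem localChristoffel_add_left (x v u u' w : E) :
    F.localChristoffel c x v (u + u') w
      = F.localChristoffel c x v u w + F.localChristoffel c x v u' w :=
  ChernAlgebra.christoffel_add_left _ _ _ _ _ _ _

theorem localChristoffel_smul_left (x v : E) (r : ℝ) (u w : E) :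
    F.localChristoffel c x v (r • u) w = r • F.localChristoffel c x v u w :=
  ChernAlgebra.christoffel_smul_left _ _ _ _ _ _ _

theorem localChristoffel_zero_left (x v w : E) : F.localChristoffel c x v 0 w = 0 := by
  simpa using localChristoffel_smul_left (F := F) (c := c) x v 0 0 w

theorem hasFDerivAt_christoffelMap {x v : E} (h : (x, v) ∈ F.chartDomain c) (u w : E) :
    HasFDerivAt (F.christoffelMap c) (fderiv ℝ (F.christoffelMap c) (x, v, u, w)) (x, v, u, w) :=
  ((contDiffAt_localChristoffel h).differentiableAt (by simp)).hasFDerivAt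

theorem fderiv_christoffelMap_left {x v : E} (h : (x, v) ∈ F.chartDomain c) (u w u' : E) :
    fderiv ℝ (F.christoffelMap c) (x, v, u, w) (0, 0, u', 0) = F.localChristoffel c x v u' w := by
  have h1 : HasDerivAt (fun r : ℝ => F.christoffelMap c ((x, v, u, w) + r • (0, 0, u', 0))) _ 0 :=
    (hasFDerivAt_christoffelMap h u w).hasLineDerivAt (0, 0, u', 0)
  have h2 : HasDerivAt (fun r : ℝ => F.localChristoffel c x v u w
      + r • F.localChristoffel c x v u' w) (F.localChristoffel c x v u' w) 0 := by
    simpa using ((hasDerivAt_id (0 : ℝ)).smul_const (F.localChristoffel c x v u' w)).const_add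
      (F.localChristoffel c x v u w)
  refine h1.unique (h2.congr_of_eventuallyEq (Filter.Eventually.of_forall fun r => ?_))
  simp [christoffelMap, localChristoffel_add_left, localChristoffel_smul_left]

/-- The derivative of the field `u` is split off as a separate Christoffel term, so that `u'` no
longer occurs in the remaining derivative of the symbols. -/
theorem hasDerivWithinAt_localChristoffel {S : Set ℝ} {t : ℝ} {x v u w : ℝ → E} {x' v' u' w' : E}
    (h : (x t, v t) ∈ F.chartDomain c) (hx : HasDerivWithinAt x x' S t)
    (hv : HasDerivWithinAt v v' S t) (hu : HasDerivWithinAt u u' S t)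
    (hw : HasDerivWithinAt w w' S t) :
    HasDerivWithinAt (fun τ => F.localChristoffel c (x τ) (v τ) (u τ) (w τ))
      (fderiv ℝ (F.christoffelMap c) (x t, v t, u t, w t) (x', v', 0, w')
        + F.localChristoffel c (x t) (v t) u' (w t)) S t := by
  have hp : HasDerivWithinAt (fun τ => (x τ, v τ, u τ, w τ)) (x', v', u', w') S t :=
    hx.prodMk (hv.prodMk (hu.prodMk hw))
  refine ((hasFDerivAt_christoffelMap h (u t) (w t)).comp_hasDerivWithinAt t hp).congr_deriv ?_
  rw [← fderiv_christoffelMap_left h (u t), ← map_add]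
  simp

/-- The commutator of the covariant derivatives of a field along a two-parameter map, in
coordinates: the derivatives of the field cancel. -/
theorem commutator_eq_localCurvature {S T : Set ℝ} {t s : ℝ} {x z : ℝ → ℝ → E}
    (hS : UniqueDiffOn ℝ S) (hT : UniqueDiffOn ℝ T)
    (hx : ContDiffWithinAt ℝ ∞ (fun q : ℝ × ℝ => x q.1 q.2) (S ×ˢ T) (t, s))
    (hz : ContDiffWithinAt ℝ ∞ (fun q : ℝ × ℝ => z q.1 q.2) (S ×ˢ T) (t, s))
    (h : (t, s) ∈ S ×ˢ T) (hcl : (t, s) ∈ closure (interior (S ×ˢ T)))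
    (hD : (x t s, derivWithin (fun τ => x τ s) S t) ∈ F.chartDomain c) :
    (derivWithin (fun τ => derivWithin (fun σ => z τ σ) T s
          + F.localChristoffel c (x τ s) (derivWithin (fun τ => x τ s) S τ) (z τ s)
            (derivWithin (fun σ => x τ σ) T s)) S t
        + F.localChristoffel c (x t s) (derivWithin (fun τ => x τ s) S t)
          (derivWithin (fun σ => z t σ) T s
            + F.localChristoffel c (x t s) (derivWithin (fun τ => x τ s) S t) (z t s)
              (derivWithin (fun σ => x t σ) T s))
          (derivWithin (fun τ => x τ s) S t))
      - (derivWithin (fun σ => derivWithin (fun τ => z τ σ) S t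
          + F.localChristoffel c (x t σ) (derivWithin (fun τ => x τ σ) S t) (z t σ)
            (derivWithin (fun τ => x τ σ) S t)) T s
        + F.localChristoffel c (x t s) (derivWithin (fun τ => x τ s) S t)
          (derivWithin (fun τ => z τ s) S t
            + F.localChristoffel c (x t s) (derivWithin (fun τ => x τ s) S t) (z t s)
              (derivWithin (fun τ => x τ s) S t))
          (derivWithin (fun σ => x t σ) T s))
      = F.localCurvature c (x t s) (derivWithin (fun τ => x τ s) S t)
          (derivWithin (fun τ => derivWithin (fun τ => x τ s) S τ) S t) (z t s)
          (derivWithin (fun σ => x t σ) T s)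
          (derivWithin (fun τ => derivWithin (fun σ => x τ σ) T s) S t) := by
  have hxt := hx.derivWithin_fst hS hT h
  have hxs := hx.derivWithin_snd hS hT h
  have hzt := hz.derivWithin_fst hS hT h
  have hzs := hz.derivWithin_snd hS hT h
  have d1 := (ContDiffWithinAt.hasDerivWithinAt_fst (f := fun t s => derivWithin (fun σ => z t σ) T s) hzs h).add
    (hasDerivWithinAt_localChristoffel hD (ContDiffWithinAt.hasDerivWithinAt_fst (f := x) hx h)
      (ContDiffWithinAt.hasDerivWithinAt_fst (f := fun t s => derivWithin (fun τ => x τ s) S t) hxt h)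
      (ContDiffWithinAt.hasDerivWithinAt_fst (f := z) hz h)
      (ContDiffWithinAt.hasDerivWithinAt_fst (f := fun t s => derivWithin (fun σ => x t σ) T s) hxs h))
  have d2 := (ContDiffWithinAt.hasDerivWithinAt_snd (f := fun t s => derivWithin (fun τ => z τ s) S t) hzt h).add
    (hasDerivWithinAt_localChristoffel hD (ContDiffWithinAt.hasDerivWithinAt_snd (f := x) hx h)
      (ContDiffWithinAt.hasDerivWithinAt_snd (f := fun t s => derivWithin (fun τ => x τ s) S t) hxt h)
      (ContDiffWithinAt.hasDerivWithinAt_snd (f := z) hz h)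
      (ContDiffWithinAt.hasDerivWithinAt_snd (f := fun t s => derivWithin (fun τ => x τ s) S t) hxt h))
  have e1 := HasDerivWithinAt.derivWithin d1 (hS _ h.1)
  have e2 := HasDerivWithinAt.derivWithin d2 (hT _ h.2)
  -- `cx` turns the transverse derivative of the velocity into the `t`-derivative of the variation
  -- field; `cz` cancels the second derivatives of `z`. The terms `Γ(∂_t z, ∂_s x)` and `Γ(∂_s z,
  -- ∂_t x)` each occur with both signs.
  have cx := ContDiffWithinAt.derivWithin_comm (f := x) hS hT hx h hcl
  have cz := ContDiffWithinAt.derivWithin_comm (f := z) hS hT hz h hcl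
  refine (congrArg₂ (fun p q => (p + _) - (q + _)) e1 e2).trans ?_
  rw [localCurvature, ← cx, ← cz, localChristoffel_add_left, localChristoffel_add_left]
  abel

end

end PseudoFinsler

/-! ### Vector fields and covariant derivatives along a two-parameter map. -/

namespace PseudoFinsler

section

variable {E : Type*} [NormedAddCommGroup E] [NormedSpace ℝ E]
  {M : Type*} [TopologicalSpace M] [ChartedSpace E M] [IsManifold 𝓘(ℝ, E) ∞ M]
  {F : PseudoFinsler E M} {c : M} {a b ε t s : ℝ} {Λ : ℝ → ℝ → M}
  {Z : ∀ t s, TangentSpace 𝓘(ℝ, E) (Λ t s)}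

/-- `Z` is a smooth vector field along the two-parameter map `Λ`. -/
def IsSmoothFieldAlongVariation (a b ε : ℝ) (Λ : ℝ → ℝ → M)
    (Z : ∀ t s, TangentSpace 𝓘(ℝ, E) (Λ t s)) : Prop :=
  ContMDiffOn 𝓘(ℝ, ℝ × ℝ) 𝓘(ℝ, E).tangent ∞
    (fun q : ℝ × ℝ => (⟨Λ q.1 q.2, Z q.1 q.2⟩ : TangentBundle 𝓘(ℝ, E) M))
    (Icc a b ×ˢ Ioo (-ε) ε)

theorem mem_closure_interior_rectangle (hab : a < b) (h : (t, s) ∈ Icc a b ×ˢ Ioo (-ε) ε) :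
    (t, s) ∈ closure (interior (Icc a b ×ˢ Ioo (-ε) ε)) := by
  rw [interior_prod_eq, interior_Icc, isOpen_Ioo.interior_eq, closure_prod_eq,
    closure_Ioo hab.ne]
  exact ⟨h.1, subset_closure h.2⟩

theorem uniqueDiffOn_Ioo_neg : UniqueDiffOn ℝ (Ioo (-ε) ε) := isOpen_Ioo.uniqueDiffOn

theorem eventually_mem_source (hΛ : IsSmoothVariation E a b ε Λ)
    (h : (t, s) ∈ Icc a b ×ˢ Ioo (-ε) ε) (hq : Λ t s ∈ (chartAt E c).source) :
    ∀ᶠ q in nhdsWithin (t, s) (Icc a b ×ˢ Ioo (-ε) ε), Λ q.1 q.2 ∈ (chartAt E c).source :=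
  (hΛ _ h).continuousWithinAt.eventually ((chartAt E c).open_source.mem_nhds hq)

theorem contDiffWithinAt_coord (hΛ : IsSmoothVariation E a b ε Λ)
    (h : (t, s) ∈ Icc a b ×ˢ Ioo (-ε) ε) (hq : Λ t s ∈ (chartAt E c).source) :
    ContDiffWithinAt ℝ ∞ (fun q : ℝ × ℝ => extChartAt 𝓘(ℝ, E) c (Λ q.1 q.2))
      (Icc a b ×ˢ Ioo (-ε) ε) (t, s) :=
  ((contMDiffAt_extChartAt' hq).comp_contMDiffWithinAt (t, s)
    (f := fun q : ℝ × ℝ => Λ q.1 q.2) (hΛ _ h)).contDiffWithinAt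

/-- In a trivialization a field along `Λ` is the pair of `Λ` and its components, and `Λ` is already
smooth. -/
theorem contMDiffWithinAt_field_iff (hΛ : IsSmoothVariation E a b ε Λ)
    (h : (t, s) ∈ Icc a b ×ˢ Ioo (-ε) ε) (hq : Λ t s ∈ (chartAt E c).source) :
    ContMDiffWithinAt 𝓘(ℝ, ℝ × ℝ) 𝓘(ℝ, E).tangent ∞
        (fun q : ℝ × ℝ => (⟨Λ q.1 q.2, Z q.1 q.2⟩ : TangentBundle 𝓘(ℝ, E) M))
        (Icc a b ×ˢ Ioo (-ε) ε) (t, s) ↔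
      ContDiffWithinAt ℝ ∞ (fun q : ℝ × ℝ => coordVec c (Z q.1 q.2))
        (Icc a b ×ˢ Ioo (-ε) ε) (t, s) := by
  have := (trivializationAt E (TangentSpace 𝓘(ℝ, E)) c).contMDiffWithinAt_iff (n := ∞)
    (IB := 𝓘(ℝ, E)) (IM := 𝓘(ℝ, ℝ × ℝ)) (s := Icc a b ×ˢ Ioo (-ε) ε) (x₀ := (t, s))
    (f := fun q : ℝ × ℝ => (⟨Λ q.1 q.2, Z q.1 q.2⟩ : TangentBundle 𝓘(ℝ, E) M)) hq
  refine this.trans ⟨fun h' => h'.2.contDiffWithinAt, fun h' => ⟨hΛ _ h, h'.contMDiffWithinAt⟩⟩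

theorem contDiffWithinAt_coordVec (hΛ : IsSmoothVariation E a b ε Λ)
    (hZ : IsSmoothFieldAlongVariation a b ε Λ Z)
    (h : (t, s) ∈ Icc a b ×ˢ Ioo (-ε) ε) (hq : Λ t s ∈ (chartAt E c).source) :
    ContDiffWithinAt ℝ ∞ (fun q : ℝ × ℝ => coordVec c (Z q.1 q.2))
      (Icc a b ×ˢ Ioo (-ε) ε) (t, s) :=
  (contMDiffWithinAt_field_iff hΛ h hq).1 (hZ _ h)

theorem mdifferentiableWithinAt_fst (hΛ : IsSmoothVariation E a b ε Λ)
    (h : (t, s) ∈ Icc a b ×ˢ Ioo (-ε) ε) :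
    MDifferentiableWithinAt 𝓘(ℝ, ℝ) 𝓘(ℝ, E) (fun τ => Λ τ s) (Icc a b) t := by
  have hl : ContMDiffWithinAt 𝓘(ℝ, ℝ) 𝓘(ℝ, ℝ × ℝ) ∞ (fun τ : ℝ => (τ, s)) (Icc a b) t :=
    ContDiffWithinAt.contMDiffWithinAt (by fun_prop)
  exact (ContMDiffWithinAt.comp (t := Icc a b ×ˢ Ioo (-ε) ε) (f := fun τ => (τ, s)) t (hΛ _ h) hl
    fun τ hτ => ⟨hτ, h.2⟩).mdifferentiableWithinAt (by simp)

theorem mdifferentiableWithinAt_snd (hΛ : IsSmoothVariation E a b ε Λ)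
    (h : (t, s) ∈ Icc a b ×ˢ Ioo (-ε) ε) :
    MDifferentiableWithinAt 𝓘(ℝ, ℝ) 𝓘(ℝ, E) (fun σ => Λ t σ) (Ioo (-ε) ε) s := by
  have hl : ContMDiffWithinAt 𝓘(ℝ, ℝ) 𝓘(ℝ, ℝ × ℝ) ∞ (fun σ : ℝ => (t, σ)) (Ioo (-ε) ε) s :=
    ContDiffWithinAt.contMDiffWithinAt (by fun_prop)
  exact (ContMDiffWithinAt.comp (t := Icc a b ×ˢ Ioo (-ε) ε) (f := fun σ => (t, σ)) s (hΛ _ h) hl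
    fun σ hσ => ⟨h.1, hσ⟩).mdifferentiableWithinAt (by simp)

theorem coordVec_velT (hab : a < b) (hΛ : IsSmoothVariation E a b ε Λ)
    (h : (t, s) ∈ Icc a b ×ˢ Ioo (-ε) ε) (hq : Λ t s ∈ (chartAt E c).source) :
    coordVec c (velT (E := E) a b Λ t s)
      = derivWithin (fun τ => extChartAt 𝓘(ℝ, E) c (Λ τ s)) (Icc a b) t :=
  coordVec_velocity (mdifferentiableWithinAt_fst hΛ h) (uniqueDiffOn_Icc hab _ h.1) hq

theorem coordVec_velS (hΛ : IsSmoothVariation E a b ε Λ)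
    (h : (t, s) ∈ Icc a b ×ˢ Ioo (-ε) ε) (hq : Λ t s ∈ (chartAt E c).source) :
    coordVec c (velS (E := E) ε Λ t s)
      = derivWithin (fun σ => extChartAt 𝓘(ℝ, E) c (Λ t σ)) (Ioo (-ε) ε) s :=
  coordVec_velocity (mdifferentiableWithinAt_snd hΛ h) (uniqueDiffOn_Ioo_neg _ h.2) hq

theorem eventually_coordVec_velT (hab : a < b) (hΛ : IsSmoothVariation E a b ε Λ)
    (h : (t, s) ∈ Icc a b ×ˢ Ioo (-ε) ε) (hq : Λ t s ∈ (chartAt E c).source) :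
    (fun q : ℝ × ℝ => coordVec c (velT (E := E) a b Λ q.1 q.2))
      =ᶠ[nhdsWithin (t, s) (Icc a b ×ˢ Ioo (-ε) ε)]
      fun q => derivWithin (fun τ => extChartAt 𝓘(ℝ, E) c (Λ τ q.2)) (Icc a b) q.1 := by
  filter_upwards [eventually_mem_source hΛ h hq, self_mem_nhdsWithin] with q hq hqm
  exact coordVec_velT hab hΛ hqm hq

theorem eventually_coordVec_velS (hΛ : IsSmoothVariation E a b ε Λ)
    (h : (t, s) ∈ Icc a b ×ˢ Ioo (-ε) ε) (hq : Λ t s ∈ (chartAt E c).source) :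
    (fun q : ℝ × ℝ => coordVec c (velS (E := E) ε Λ q.1 q.2))
      =ᶠ[nhdsWithin (t, s) (Icc a b ×ˢ Ioo (-ε) ε)]
      fun q => derivWithin (fun σ => extChartAt 𝓘(ℝ, E) c (Λ q.1 σ)) (Ioo (-ε) ε) q.2 := by
  filter_upwards [eventually_mem_source hΛ h hq, self_mem_nhdsWithin] with q hq hqm
  exact coordVec_velS hΛ hqm hq

theorem isSmoothFieldAlongVariation_velT (hab : a < b) (hΛ : IsSmoothVariation E a b ε Λ) :
    IsSmoothFieldAlongVariation (E := E) a b ε Λ (velT a b Λ) := by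
  intro q h
  have hq := mem_chart_source E (Λ q.1 q.2)
  exact (contMDiffWithinAt_field_iff hΛ h hq).2
    ((ContDiffWithinAt.derivWithin_fst (f := fun t s => extChartAt 𝓘(ℝ, E) (Λ q.1 q.2) (Λ t s))
      (uniqueDiffOn_Icc hab) uniqueDiffOn_Ioo_neg
      (contDiffWithinAt_coord hΛ h hq) h).congr_of_eventuallyEq_of_mem
      (eventually_coordVec_velT hab hΛ h hq) h)

theorem isSmoothFieldAlongVariation_velS (hab : a < b) (hΛ : IsSmoothVariation E a b ε Λ) :
    IsSmoothFieldAlongVariation (E := E) a b ε Λ (velS ε Λ) := by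
  intro q h
  have hq := mem_chart_source E (Λ q.1 q.2)
  exact (contMDiffWithinAt_field_iff hΛ h hq).2
    ((ContDiffWithinAt.derivWithin_snd (f := fun t s => extChartAt 𝓘(ℝ, E) (Λ q.1 q.2) (Λ t s))
      (uniqueDiffOn_Icc hab) uniqueDiffOn_Ioo_neg
      (contDiffWithinAt_coord hΛ h hq) h).congr_of_eventuallyEq_of_mem
      (eventually_coordVec_velS hΛ h hq) h)

variable [FiniteDimensional ℝ E]

theorem coordVec_covT (hab : a < b) (hΛ : IsSmoothVariation E a b ε Λ)
    (hA : ∀ s ∈ Ioo (-ε) ε, F.IsAdmissible a b (fun t => Λ t s))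
    (h : (t, s) ∈ Icc a b ×ˢ Ioo (-ε) ε) (hq : Λ t s ∈ (chartAt E c).source)
    (hZ : DifferentiableWithinAt ℝ (fun τ => coordVec c (Z τ s)) (Icc a b) t) :
    coordVec c (F.covT a b Λ Z t s) = derivWithin (fun τ => coordVec c (Z τ s)) (Icc a b) t
      + F.localChristoffel c (extChartAt 𝓘(ℝ, E) c (Λ t s))
        (derivWithin (fun τ => extChartAt 𝓘(ℝ, E) c (Λ τ s)) (Icc a b) t) (coordVec c (Z t s))
        (derivWithin (fun τ => extChartAt 𝓘(ℝ, E) c (Λ τ s)) (Icc a b) t) := by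
  have := coordVec_covDeriv (F := F) (W := fun τ => velT a b Λ τ s) (X := fun τ => Z τ s)
    (mdifferentiableWithinAt_fst hΛ h) (uniqueDiffOn_Icc hab _ h.1) hq (hA s h.2 t h.1) hZ
  rwa [coordVec_velT hab hΛ h hq] at this

theorem coordVec_covS (hab : a < b) (hΛ : IsSmoothVariation E a b ε Λ)
    (hA : ∀ s ∈ Ioo (-ε) ε, F.IsAdmissible a b (fun t => Λ t s))
    (h : (t, s) ∈ Icc a b ×ˢ Ioo (-ε) ε) (hq : Λ t s ∈ (chartAt E c).source)
    (hZ : DifferentiableWithinAt ℝ (fun σ => coordVec c (Z t σ)) (Ioo (-ε) ε) s) :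
    coordVec c (F.covS a b ε Λ Z t s) = derivWithin (fun σ => coordVec c (Z t σ)) (Ioo (-ε) ε) s
      + F.localChristoffel c (extChartAt 𝓘(ℝ, E) c (Λ t s))
        (derivWithin (fun τ => extChartAt 𝓘(ℝ, E) c (Λ τ s)) (Icc a b) t) (coordVec c (Z t s))
        (derivWithin (fun σ => extChartAt 𝓘(ℝ, E) c (Λ t σ)) (Ioo (-ε) ε) s) := by
  have := coordVec_covDeriv (F := F) (W := fun σ => velT a b Λ t σ) (X := fun σ => Z t σ)
    (mdifferentiableWithinAt_snd hΛ h) (uniqueDiffOn_Ioo_neg _ h.2) hq (hA s h.2 t h.1) hZ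
  rwa [coordVec_velT hab hΛ h hq] at this

theorem differentiableWithinAt_coordVec_fst (hΛ : IsSmoothVariation E a b ε Λ)
    (hZ : IsSmoothFieldAlongVariation a b ε Λ Z)
    (h : (t, s) ∈ Icc a b ×ˢ Ioo (-ε) ε) (hq : Λ t s ∈ (chartAt E c).source) :
    DifferentiableWithinAt ℝ (fun τ => coordVec c (Z τ s)) (Icc a b) t :=
  (ContDiffWithinAt.hasDerivWithinAt_fst (f := fun t s => coordVec c (Z t s))
    (contDiffWithinAt_coordVec hΛ hZ h hq) h).differentiableWithinAt

theorem differentiableWithinAt_coordVec_snd (hΛ : IsSmoothVariation E a b ε Λ)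
    (hZ : IsSmoothFieldAlongVariation a b ε Λ Z)
    (h : (t, s) ∈ Icc a b ×ˢ Ioo (-ε) ε) (hq : Λ t s ∈ (chartAt E c).source) :
    DifferentiableWithinAt ℝ (fun σ => coordVec c (Z t σ)) (Ioo (-ε) ε) s :=
  (ContDiffWithinAt.hasDerivWithinAt_snd (f := fun t s => coordVec c (Z t s))
    (contDiffWithinAt_coordVec hΛ hZ h hq) h).differentiableWithinAt

/-- The Chern connection is torsion free: `D_t Λ_s = D_s Λ_t`. -/
theorem covT_velS (hab : a < b) (hΛ : IsSmoothVariation E a b ε Λ)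
    (hA : ∀ s ∈ Ioo (-ε) ε, F.IsAdmissible a b (fun t => Λ t s))
    (h : (t, s) ∈ Icc a b ×ˢ Ioo (-ε) ε) :
    F.covT a b Λ (velS ε Λ) t s = F.covS a b ε Λ (velT a b Λ) t s := by
  have hq := mem_chart_source E (Λ t s)
  have e1 := (tendsto_slice_fst h).eventually (eventually_coordVec_velS hΛ h hq)
  have e2 := (tendsto_slice_snd h).eventually (eventually_coordVec_velT hab hΛ h hq)
  have hD := mem_chartDomain (F := F) hq (hA s h.2 t h.1)
  apply coordVec_injective hq
  rw [coordVec_covT hab hΛ hA h hq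
      (differentiableWithinAt_coordVec_fst hΛ (isSmoothFieldAlongVariation_velS hab hΛ) h hq),
    coordVec_covS hab hΛ hA h hq
      (differentiableWithinAt_coordVec_snd hΛ (isSmoothFieldAlongVariation_velT hab hΛ) h hq),
    coordVec_velT hab hΛ h hq, coordVec_velS hΛ h hq,
    Filter.EventuallyEq.derivWithin_eq e1 (e1.self_of_nhdsWithin h.1),
    Filter.EventuallyEq.derivWithin_eq e2 (e2.self_of_nhdsWithin h.2),
    ContDiffWithinAt.derivWithin_comm (f := fun t' s' => extChartAt 𝓘(ℝ, E) (Λ t s) (Λ t' s'))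
      (uniqueDiffOn_Icc hab) uniqueDiffOn_Ioo_neg (contDiffWithinAt_coord hΛ h hq) h
      (mem_closure_interior_rectangle hab h)]
  -- Back to components of vectors, so that the reference vector is the one in `hD`; only the
  -- symmetry of the Christoffel symbols is left.
  rw [← coordVec_velT hab hΛ h hq, ← coordVec_velS hΛ h hq]
  congr 1
  exact (localChristoffel_spec hD).1 _ _

/-- The inner covariant derivatives agree with their expressions in the fixed chart near the point
(`eT`, `eS`). These expressions are differentiable, so the outer derivatives can be computed from
them, and the commutator formula applies. -/
theorem coordVec_curvatureVar (hab : a < b) (hΛ : IsSmoothVariation E a b ε Λ)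
    (hA : ∀ s ∈ Ioo (-ε) ε, F.IsAdmissible a b (fun t => Λ t s))
    (hZ : IsSmoothFieldAlongVariation a b ε Λ Z)
    (h : (t, s) ∈ Icc a b ×ˢ Ioo (-ε) ε) (hq : Λ t s ∈ (chartAt E c).source) :
    coordVec c (F.curvatureVar a b ε Λ Z t s) = F.localCurvature c (extChartAt 𝓘(ℝ, E) c (Λ t s))
      (derivWithin (fun τ => extChartAt 𝓘(ℝ, E) c (Λ τ s)) (Icc a b) t)
      (derivWithin (fun τ => derivWithin (fun τ => extChartAt 𝓘(ℝ, E) c (Λ τ s)) (Icc a b) τ)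
        (Icc a b) t)
      (coordVec c (Z t s)) (coordVec c (velS (E := E) ε Λ t s))
      (derivWithin (fun τ => coordVec c (velS (E := E) ε Λ τ s)) (Icc a b) t) := by
  have hS : UniqueDiffOn ℝ (Icc a b) := uniqueDiffOn_Icc hab
  have hT : UniqueDiffOn ℝ (Ioo (-ε) ε) := uniqueDiffOn_Ioo_neg
  have hcl := mem_closure_interior_rectangle hab h
  set x : ℝ → ℝ → E := fun t s => extChartAt 𝓘(ℝ, E) c (Λ t s) with hx
  set z : ℝ → ℝ → E := fun t s => coordVec c (Z t s) with hz
  have hxs : ContDiffWithinAt ℝ ∞ (fun q : ℝ × ℝ => x q.1 q.2) (Icc a b ×ˢ Ioo (-ε) ε) (t, s) :=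
    contDiffWithinAt_coord hΛ h hq
  have hzs : ContDiffWithinAt ℝ ∞ (fun q : ℝ × ℝ => z q.1 q.2) (Icc a b ×ˢ Ioo (-ε) ε) (t, s) :=
    contDiffWithinAt_coordVec hΛ hZ h hq
  have hD : (x t s, derivWithin (fun τ => x τ s) (Icc a b) t) ∈ F.chartDomain c := by
    have := mem_chartDomain (F := F) hq (hA s h.2 t h.1)
    rwa [coordVec_velocity (mdifferentiableWithinAt_fst hΛ h) (hS _ h.1) hq] at this
  have hxt := ContDiffWithinAt.derivWithin_fst hS hT hxs h
  have hxS := ContDiffWithinAt.derivWithin_snd hS hT hxs h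
  have eT : (fun σ => coordVec c (F.covT a b Λ Z t σ)) =ᶠ[nhdsWithin s (Ioo (-ε) ε)] fun σ =>
      derivWithin (fun τ => z τ σ) (Icc a b) t + F.localChristoffel c (x t σ)
        (derivWithin (fun τ => x τ σ) (Icc a b) t) (z t σ)
        (derivWithin (fun τ => x τ σ) (Icc a b) t) := by
    filter_upwards [(tendsto_slice_snd h).eventually (eventually_mem_source hΛ h hq),
      self_mem_nhdsWithin] with σ hσ hσm
    exact coordVec_covT hab hΛ hA ⟨h.1, hσm⟩ hσ
      (differentiableWithinAt_coordVec_fst hΛ hZ ⟨h.1, hσm⟩ hσ)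
  have eS : (fun τ => coordVec c (F.covS a b ε Λ Z τ s)) =ᶠ[nhdsWithin t (Icc a b)] fun τ =>
      derivWithin (fun σ => z τ σ) (Ioo (-ε) ε) s + F.localChristoffel c (x τ s)
        (derivWithin (fun τ => x τ s) (Icc a b) τ) (z τ s)
        (derivWithin (fun σ => x τ σ) (Ioo (-ε) ε) s) := by
    filter_upwards [(tendsto_slice_fst h).eventually (eventually_mem_source hΛ h hq),
      self_mem_nhdsWithin] with τ hτ hτm
    exact coordVec_covS hab hΛ hA ⟨hτm, h.2⟩ hτ
      (differentiableWithinAt_coordVec_snd hΛ hZ ⟨hτm, h.2⟩ hτ)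
  have dT := (hasDerivWithinAt_localChristoffel hD
    (ContDiffWithinAt.hasDerivWithinAt_snd (f := x) hxs h)
    (ContDiffWithinAt.hasDerivWithinAt_snd
      (f := fun t s => derivWithin (fun τ => x τ s) (Icc a b) t) hxt h)
    (ContDiffWithinAt.hasDerivWithinAt_snd (f := z) hzs h)
    (ContDiffWithinAt.hasDerivWithinAt_snd
      (f := fun t s => derivWithin (fun τ => x τ s) (Icc a b) t) hxt h)).differentiableWithinAt
  have dS := (hasDerivWithinAt_localChristoffel hD
    (ContDiffWithinAt.hasDerivWithinAt_fst (f := x) hxs h)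
    (ContDiffWithinAt.hasDerivWithinAt_fst
      (f := fun t s => derivWithin (fun τ => x τ s) (Icc a b) t) hxt h)
    (ContDiffWithinAt.hasDerivWithinAt_fst (f := z) hzs h)
    (ContDiffWithinAt.hasDerivWithinAt_fst
      (f := fun t s => derivWithin (fun σ => x t σ) (Ioo (-ε) ε) s) hxS h)).differentiableWithinAt
  have dT' := ((ContDiffWithinAt.hasDerivWithinAt_snd
    (f := fun t s => derivWithin (fun τ => z τ s) (Icc a b) t)
    (ContDiffWithinAt.derivWithin_fst hS hT hzs h) h).differentiableWithinAt.add
      dT).congr_of_eventuallyEq eT (eT.self_of_nhdsWithin h.2)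
  have dS' := ((ContDiffWithinAt.hasDerivWithinAt_fst
    (f := fun t s => derivWithin (fun σ => z t σ) (Ioo (-ε) ε) s)
    (ContDiffWithinAt.derivWithin_snd hS hT hzs h) h).differentiableWithinAt.add
      dS).congr_of_eventuallyEq eS (eS.self_of_nhdsWithin h.1)
  have eV := (tendsto_slice_fst h).eventually (eventually_coordVec_velS hΛ h hq)
  rw [curvatureVar, coordVec_sub, coordVec_covT hab hΛ hA h hq dS',
    coordVec_covS hab hΛ hA h hq dT', eT.derivWithin_eq (eT.self_of_nhdsWithin h.2),
    eS.derivWithin_eq (eS.self_of_nhdsWithin h.1),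
    coordVec_covT hab hΛ hA h hq (differentiableWithinAt_coordVec_fst hΛ hZ h hq),
    coordVec_covS hab hΛ hA h hq (differentiableWithinAt_coordVec_snd hΛ hZ h hq),
    Filter.EventuallyEq.derivWithin_eq eV (eV.self_of_nhdsWithin h.1), coordVec_velS hΛ h hq]
  exact commutator_eq_localCurvature hS hT hxs hzs h hcl hD

end

end PseudoFinsler

/-! ### Independence of the variation and the extension, and the Jacobi equation. -/

namespace PseudoFinsler

section

variable {E : Type*} [NormedAddCommGroup E] [NormedSpace ℝ E] [FiniteDimensional ℝ E]
  {M : Type*} [TopologicalSpace M] [ChartedSpace E M] [IsManifold 𝓘(ℝ, E) ∞ M]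
  {F : PseudoFinsler E M} {c : M} {a b ε t s : ℝ} {Λ : ℝ → ℝ → M}

theorem coordVec_congr {p q : M} {V : TangentSpace 𝓘(ℝ, E) p} {W : TangentSpace 𝓘(ℝ, E) q}
    (h : (⟨p, V⟩ : TangentBundle 𝓘(ℝ, E) M) = ⟨q, W⟩) : coordVec c V = coordVec c W :=
  congrArg (fun U : TangentBundle 𝓘(ℝ, E) M => (trivializationAt E (TangentSpace 𝓘(ℝ, E)) c U).2) h

/-- The curvature along `γ`, computed with any variation and any extension, is determined by `γ`,
the variation field and the field to which it is applied. -/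
theorem IsExtension.curvatureVar_eq {γ : ℝ → M} {W Z : ∀ t, TangentSpace 𝓘(ℝ, E) (γ t)}
    {Z' : ∀ t s, TangentSpace 𝓘(ℝ, E) (Λ t s)} (hab : a < b)
    (he : F.IsExtension a b γ W Z ε Λ Z') (ht : t ∈ Icc a b) (hq : γ t ∈ (chartAt E c).source) :
    (⟨Λ t 0, F.curvatureVar a b ε Λ Z' t 0⟩ : TangentBundle 𝓘(ℝ, E) M)
      = tangentOfCoord c (extChartAt 𝓘(ℝ, E) c (γ t),
        F.localCurvature c (extChartAt 𝓘(ℝ, E) c (γ t))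
          (derivWithin (fun τ => extChartAt 𝓘(ℝ, E) c (γ τ)) (Icc a b) t)
          (derivWithin (fun τ => derivWithin (fun τ => extChartAt 𝓘(ℝ, E) c (γ τ)) (Icc a b) τ)
            (Icc a b) t)
          (coordVec c (Z t)) (coordVec c (W t))
          (derivWithin (fun τ => coordVec c (W τ)) (Icc a b) t)) := by
  -- Agreement of `Λ(·, 0)` with `γ` is known only on `[a, b]`, which suffices because all
  -- derivatives are taken within that interval.
  have hΛγ : ∀ τ ∈ Icc a b, Λ τ 0 = γ τ := fun τ hτ =>
    congrArg Bundle.TotalSpace.proj (he.variationField τ hτ)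
  have hx : ∀ τ ∈ Icc a b, extChartAt 𝓘(ℝ, E) c (Λ τ 0) = extChartAt 𝓘(ℝ, E) c (γ τ) :=
    fun τ hτ => by rw [hΛγ τ hτ]
  have hv : ∀ τ ∈ Icc a b, derivWithin (fun τ => extChartAt 𝓘(ℝ, E) c (Λ τ 0)) (Icc a b) τ
      = derivWithin (fun τ => extChartAt 𝓘(ℝ, E) c (γ τ)) (Icc a b) τ :=
    fun τ hτ => derivWithin_congr hx (hx τ hτ)
  have hw : ∀ τ ∈ Icc a b, coordVec c (velS (E := E) ε Λ τ 0) = coordVec c (W τ) :=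
    fun τ hτ => coordVec_congr (he.variationField τ hτ)
  have hq' : Λ t 0 ∈ (chartAt E c).source := by rwa [hΛγ t ht]
  have h0 : (0 : ℝ) ∈ Ioo (-ε) ε := ⟨neg_lt_zero.2 he.pos, he.pos⟩
  rw [← tangentOfCoord_coordVec hq',
    coordVec_curvatureVar hab he.smooth he.admissible he.smooth_field ⟨ht, h0⟩ hq', hx t ht,
    hv t ht, derivWithin_congr hv (hv t ht), coordVec_congr (he.extends_field t ht), hw t ht,
    derivWithin_congr hw (hw t ht)]

theorem covDeriv_congr {S : Set ℝ} {γ : ℝ → M} {W X X' : ∀ t, TangentSpace 𝓘(ℝ, E) (γ t)}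
    (ht : t ∈ S) (h : ∀ τ ∈ S, X τ = X' τ) : F.covDeriv S γ W X t = F.covDeriv S γ W X' t := by
  have hc : ∀ τ ∈ S, coordVec (γ t) (X τ) = coordVec (γ t) (X' τ) := fun τ hτ => by rw [h τ hτ]
  rw [covDeriv, covDeriv, covDerivInChart, covDerivInChart, derivWithin_congr hc (hc t ht),
    hc t ht]

/-- Vanishing along the whole transverse curve kills the derivative term, and linearity in the field
kills the Christoffel term without any regularity or admissibility. Applied to `D_t Λ_t`, it is
where all the curves, not only the central one, must be geodesics. -/
theorem covS_eq_zero {Z : ∀ t s, TangentSpace 𝓘(ℝ, E) (Λ t s)} (hs : s ∈ Ioo (-ε) ε)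
    (hZ : ∀ σ ∈ Ioo (-ε) ε, Z t σ = 0) : F.covS a b ε Λ Z t s = 0 := by
  have hc : ∀ σ ∈ Ioo (-ε) ε, coordVec (Λ t s) (Z t σ) = 0 := fun σ hσ => by
    rw [hZ σ hσ, coordVec_zero]
  rw [covS, covDeriv, covDerivInChart, derivWithin_congr hc (hc s hs), hc s hs,
    localChristoffel_zero_left]
  simpa using ofCoord_smul (mem_chart_source E (Λ t s)) 0 0

end

end PseudoFinsler

end

/-- The variation vector field `J(t) = Λ_s(t, 0)` of a variation `Λ : [a, b] × (-ε, ε) → M`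
through geodesics is a Jacobi field of the geodesic `t ↦ Λ(t, 0)`. -/
theorem proposition3p13 {E : Type*} [NormedAddCommGroup E] [NormedSpace ℝ E]
    [FiniteDimensional ℝ E] {M : Type*} [TopologicalSpace M] [ChartedSpace E M]
    [IsManifold 𝓘(ℝ, E) ∞ M] (F : PseudoFinsler E M) (a b ε : ℝ) (hab : a < b) (hε : 0 < ε)
    (Λ : ℝ → ℝ → M) (hΛ : PseudoFinsler.IsSmoothVariation E a b ε Λ)
    (hgeo : ∀ s ∈ Set.Ioo (-ε) ε, F.IsGeodesic a b (fun t => Λ t s)) :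
    F.IsJacobiField a b (fun t => Λ t 0) (fun t => PseudoFinsler.velS ε Λ t 0) := by

  have h0 : (0 : ℝ) ∈ Set.Ioo (-ε) ε := ⟨neg_lt_zero.2 hε, hε⟩
  have hA : ∀ s ∈ Set.Ioo (-ε) ε, F.IsAdmissible a b (fun t => Λ t s) :=
    fun s hs => (hgeo s hs).admissible
  -- The given variation, with its own longitudinal velocity as the extended field, is an admissible
  -- choice.
  have hext : F.IsExtension a b (fun t => Λ t 0) (fun t => PseudoFinsler.velS ε Λ t 0)
      (PseudoFinsler.velocity (Set.Icc a b) (fun t => Λ t 0)) ε Λ (PseudoFinsler.velT a b Λ) :=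
    ⟨hε, hΛ, hA, fun _ _ => rfl, PseudoFinsler.isSmoothFieldAlongVariation_velT hab hΛ,
      fun _ _ => rfl⟩
  refine ⟨hgeo 0 h0, ?_, ⟨ε, Λ, _, hext⟩, fun ε' Λ' Z' hext' t ht => ?_⟩
  · have hl : ContMDiffOn 𝓘(ℝ, ℝ) 𝓘(ℝ, ℝ × ℝ) ∞ (fun t : ℝ => (t, (0 : ℝ))) (Set.Icc a b) :=
      ContDiffOn.contMDiffOn (by fun_prop)
    exact ContMDiffOn.comp (t := Set.Icc a b ×ˢ Set.Ioo (-ε) ε)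
      (PseudoFinsler.isSmoothFieldAlongVariation_velS hab hΛ) hl fun t ht => ⟨ht, h0⟩
  · have hq := mem_chart_source E (Λ t 0)
    -- An arbitrary choice has the same coordinate expression as the choice `hext`, so only the
    -- latter has to be examined.
    rw [hext'.curvatureVar_eq hab ht hq, ← hext.curvatureVar_eq hab ht hq]
    congr 1
    have hS : F.covS a b ε Λ (F.covT a b Λ (PseudoFinsler.velT a b Λ)) t 0 = 0 :=
      PseudoFinsler.covS_eq_zero h0 fun σ hσ => (hgeo σ hσ).parallel t ht
    rw [PseudoFinsler.curvatureVar, hS, sub_zero]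
    -- With `D_s D_t Λ_t` gone, `D_t D_s Λ_t = D_t D_t Λ_s` remains; it suffices to compare the
    -- inner derivatives on `[a, b]`.
    refine PseudoFinsler.covDeriv_congr ht fun τ hτ => ?_
    exact (PseudoFinsler.covT_velS hab hΛ hA ⟨hτ, h0⟩).symm
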